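/- **Setting.** Let $\mathbb C=A_0\subseteq A_1\subseteq A_2\subseteq\cdots$ be atomic $W^*$-algebras with separable preduals and unital normal inclusions, $A=\varinjlim A_n$ their $C^*$-inductive limit, and $\alpha^t:\mathbb R\curvearrowright A$ a flow with $\alpha^t(A_n)=A_n$ such that every restriction $\alpha_n^t=\alpha^t|_{A_n}$ is continuous in the $u$-topology (i.e. $t\mapsto\omega\circ\alpha_n^t$ is norm continuous for every $\omega\in (A_n)_*$). Let $\mathcal Z(A_n)$ be the center of $A_n$ and $\mathfrak Z_n$ the set of minimal projections of $\mathcal Z(A_n)$. Fix $\beta\in\mathbb R$ such that for every $n$ and $z\in\mathfrak Z_n$ there is a unique normal $(\alpha^t|_{zA_n},\beta)$-KMS state $\tau_z$ on $zA_n$, where the KMS condition is normalized as $\tau_z(ab)=\tau_z(b\,\alpha^{i\beta}(a))$. Put $$E_n(a)=\sum_{z\in\mathfrak Z_n}\tau_z(za)\,z\in\mathcal Z(A_n)\qquad(a\in A_n),$$ a $\sigma$-weakly convergent sum, let $\Theta_{n+1,n}=E_{n+1}|_{\mathcal Z(A_n)}:\mathcal Z(A_n)\to\mathcal Z(A_{n+1})$,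 and let $\ddot{\mathcal S}=\varinjlim(\mathcal Z(A_n),\Theta_{n+1,n})$ be the inductive limit vector space, with canonical maps $\ddot\Theta_{\infty,n}:\mathcal Z(A_n)\to\ddot{\mathcal S}$, with positive cone $\bigcup_n\ddot\Theta_{\infty,n}(\mathcal Z(A_n)^+)$ and with order unit $\ddot e=\ddot\Theta_{\infty,0}(1)$. Let $q:\ddot{\mathcal S}\to\mathcal S$ be its Archimedeanization, i.e. the quotient by the subspace on which all states of $\ddot{\mathcal S}$ vanish, and put $\Theta_{\infty,n}=q\circ\ddot\Theta_{\infty,n}$, $e=q(\ddot e)$. A *left multiplicative structure* is a family of normal injective $*$-homomorphisms $\iota_{m,n}:A_m\bar\otimes A_n\to A_{m+n}$ ($m,n\ge0$; $\bar\otimes$ is the $W^*$-tensor product) such that - (m1) $\iota_{0,n}$ and $\iota_{m,0}$ are the natural identifications $\mathbb C\otimes A_n\cong A_n$ and $A_m\otimes\mathbb C\cong A_m$; - (m2) $\iota_{\ell+m,n}\circ(\iota_{\ell,m}\bar\otimes\mathrm{id})=\iota_{\ell,m+n}\circ(\mathrm{id}\bar\otimes\iota_{m,n})$; - (m3) $\iota_{m,n}\circ(\alpha_m^t\bar\otimes\alpha_n^t)=\alpha_{m+n}^t\circ\iota_{m,n}$;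 - (L) $\iota_{n,1}(a\otimes1)=a$ for $a\in A_n\subseteq A_{n+1}$. Let $\Sigma=\bigoplus_{n\ge0}\mathcal Z(A_n)$ be the algebraic direct sum, write $1_n\in\Sigma$ for the unit of $\mathcal Z(A_n)$, and give $\Sigma$ the topology induced from $\prod_n\mathcal Z(A_n)$, the product of the $\sigma$-weak topologies. **Theorem.** Given a left multiplicative structure $(\iota_{m,n})$, the following hold. 1. $\Sigma$ is a unital associative $\mathbb C$-algebra with multiplication $$\Big(\sum_n f_n\Big)\cdot\Big(\sum_n g_n\Big)=\sum_n\Big(\sum_{k+\ell=n}E_n(\iota_{k,\ell}(f_k\otimes g_\ell))\Big)$$ and unit $1_0$, and the multiplication is separately continuous. 2. The assignment $$f\cdot\ddot\Theta_{\infty,n}(g)=\ddot\Theta_{\infty,m+n}\big(E_{m+n}(\iota_{m,n}(f\otimes g))\big)\qquad(f\in\mathcal Z(A_m),\ g\in\mathcal Z(A_n))$$ is well defined and gives a left $\Sigma$-module structure on $\ddot{\mathcal S}$. The same holds for $\mathcal S$ with $\Theta_{\infty,n}$ in place of $\ddot\Theta_{\infty,n}$. Moreover $f\cdot\ddot e=\ddot\Theta_{\infty,m}(f)$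 and $f\cdot e=\Theta_{\infty,m}(f)$ for all $m\ge0$ and $f\in\mathcal Z(A_m)$. 3. For every $n\ge0$ and $f\in\mathcal Z(A_n)$ one has $f\cdot1_1=E_{n+1}(f)$ in $\Sigma$. The linear map $x\in\Sigma\mapsto x\cdot\ddot e\in\ddot{\mathcal S}$ is surjective, its kernel is the principal left ideal $\Sigma\cdot(1_1-1_0)$, and hence it induces an isomorphism $\Sigma/(\Sigma\cdot(1_1-1_0))\cong\ddot{\mathcal S}$ of left $\Sigma$-modules. -/

import Mathlib

open scoped TensorProduct ComplexOrder Topology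

noncomputable section

/-! ### Operators on Hilbert spaces: the `σ`-weak topology and the `W⋆`-tensor product -/

/-- The `σ`-weak (ultraweak) topology on `B(H)`: the coarsest topology making all functionals
`x ↦ ∑ᵢ ⟪ξᵢ, x ηᵢ⟫` with `ξ, η ∈ ℓ²(ℕ, H)` continuous. -/
@[reducible] def sigmaWeakTopology (H : Type*) [NormedAddCommGroup H] [InnerProductSpace ℂ H] :
    TopologicalSpace (H →L[ℂ] H) :=
  ⨅ p : lp (fun _ : ℕ => H) 2 × lp (fun _ : ℕ => H) 2,
    TopologicalSpace.induced (fun x : H →L[ℂ] H => ∑' i : ℕ, inner ℂ (p.1 i) (x (p.2 i)))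
      inferInstance

/-- The Hilbert space tensor product (completed algebraic tensor product). -/
abbrev HilbertTensor (H K : Type*) [NormedAddCommGroup H] [InnerProductSpace ℂ H]
    [NormedAddCommGroup K] [InnerProductSpace ℂ K] : Type _ :=
  UniformSpace.Completion (H ⊗[ℂ] K)

/-- The operator `S ⊗ T` on the Hilbert space tensor product. -/
def opTensor {H K : Type*} [NormedAddCommGroup H] [InnerProductSpace ℂ H]
    [NormedAddCommGroup K] [InnerProductSpace ℂ K] (S : H →L[ℂ] H) (T : K →L[ℂ] K) :
    HilbertTensor H K →L[ℂ] HilbertTensor H K :=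
  (TensorProduct.mapL S T).completion

/-- The von Neumann algebra on the Hilbert space tensor product generated (as a bicommutant) by
the operators `S ⊗ T` with `S ∈ M` and `T ∈ N`. -/
def vnTensor {H K : Type*} [NormedAddCommGroup H] [InnerProductSpace ℂ H]
    [NormedAddCommGroup K] [InnerProductSpace ℂ K]
    (M : Set (H →L[ℂ] H)) (N : Set (K →L[ℂ] K)) :
    StarSubalgebra ℂ (HilbertTensor H K →L[ℂ] HilbertTensor H K) :=
  StarSubalgebra.centralizer ℂ
    (StarSubalgebra.centralizer ℂ (Set.image2 opTensor M N) :
      Set (HilbertTensor H K →L[ℂ] HilbertTensor H K))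

theorem opTensor_mem_vnTensor {H K : Type*} [NormedAddCommGroup H] [InnerProductSpace ℂ H]
    [NormedAddCommGroup K] [InnerProductSpace ℂ K]
    {M : Set (H →L[ℂ] H)} {N : Set (K →L[ℂ] K)} {S : H →L[ℂ] H} {T : K →L[ℂ] K}
    (hS : S ∈ M) (hT : T ∈ N) : opTensor S T ∈ vnTensor M N := by
  rw [vnTensor, StarSubalgebra.mem_centralizer_iff]
  intro g hg
  have key : ∀ g ∈ StarSubalgebra.centralizer ℂ (Set.image2 opTensor M N),
      g * opTensor S T = opTensor S T * g := fun g hg =>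
    ((StarSubalgebra.mem_centralizer_iff ℂ).1 hg _ (Set.mem_image2_of_mem hS hT)).1.symm
  exact ⟨key g hg, key _ (star_mem hg)⟩

/-! ### Projections -/

/-- A minimal projection of a `*`-ring: a nonzero projection all of whose subprojections are
trivial (`r ≤ q` for projections is expressed as `r * q = r`). -/
def IsMinimalProjection {R : Type*} [Ring R] [StarRing R] (q : R) : Prop :=
  IsStarProjection q ∧ q ≠ 0 ∧ ∀ r : R, IsStarProjection r → r * q = r → r = 0 ∨ r = q

/-- A minimal projection of the center. -/
def IsMinimalCentralProjection {R : Type*} [Ring R] [StarRing R] (z : R) : Prop :=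
  IsStarProjection z ∧ z ∈ Subring.center R ∧ z ≠ 0 ∧
    ∀ r : R, IsStarProjection r → r ∈ Subring.center R → r * z = r → r = 0 ∨ r = z

/-! ### Inductive sequences of atomic `W⋆`-algebras with a flow -/

/-- An inductive sequence `ℂ = A₀ ⊆ A₁ ⊆ ⋯` of atomic `W⋆`-algebras with separable preduals and
unital normal inclusions, with `C⋆`-inductive limit `A`, together with a flow `αᵗ` on `A` that
preserves every `Aₙ` and whose restriction to `Aₙ` is continuous in the `u`-topology.

That `Aₙ` is a `W⋆`-algebra with separable predual is expressed by a faithful unital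
`*`-representation of `Aₙ` on a separable Hilbert space `H n` whose range is a von Neumann algebra,
i.e. equal to its bicommutant. (The induced `σ`-weak topology does not depend on it.) -/
structure AtomicFlowSequence (A : Type*) [CStarAlgebra A] (H : ℕ → Type*)
    [∀ n, NormedAddCommGroup (H n)] [∀ n, InnerProductSpace ℂ (H n)]
    [∀ n, CompleteSpace (H n)] where
  separable : ∀ n, TopologicalSpace.SeparableSpace (H n)
  /-- the algebras `Aₙ`, as unital `*`-subalgebras of the inductive limit `A` -/
  alg : ℕ → StarSubalgebra ℂ A
  alg_mono : Monotone alg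
  alg_zero : alg 0 = ⊥
  dense_iUnion : Dense (⋃ n, (alg n : Set A))
  /-- the realization of `Aₙ` as a von Neumann algebra -/
  rep : ∀ n, alg n →⋆ₐ[ℂ] (H n →L[ℂ] H n)
  rep_injective : ∀ n, Function.Injective (rep n)
  rep_bicommutant : ∀ n,
    Set.centralizer (Set.centralizer (Set.range (rep n))) = Set.range (rep n)
  /-- the inclusions `Aₙ ⊆ Aₙ₊₁` are normal, i.e. `σ`-weakly continuous -/
  incl_normal : ∀ n,
    Continuous[TopologicalSpace.induced (rep n) (sigmaWeakTopology (H n)),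
      TopologicalSpace.induced (rep (n + 1)) (sigmaWeakTopology (H (n + 1)))]
      (StarSubalgebra.inclusion (alg_mono (Nat.le_succ n)))
  /-- `Aₙ` is atomic: every nonzero projection dominates a minimal projection -/
  atomic : ∀ n, ∀ p : alg n, IsStarProjection p → p ≠ 0 →
    ∃ q : alg n, IsMinimalProjection q ∧ q * p = q
  /-- the flow `αᵗ` -/
  flow : ℝ → A ≃⋆ₐ[ℂ] A
  flow_add : ∀ s t a, flow (s + t) a = flow s (flow t a)
  flow_mem_iff : ∀ t n a, flow t a ∈ alg n ↔ a ∈ alg n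
  /-- continuity in the `u`-topology: `t ↦ ω ∘ αᵗ` is norm continuous for every normal functional
  `ω` on `Aₙ` -/
  flow_u_continuous : ∀ n, ∀ ω : alg n →ₗ[ℂ] ℂ,
    Continuous[TopologicalSpace.induced (rep n) (sigmaWeakTopology (H n)), inferInstance] ω →
    ∀ t₀ : ℝ, ∀ ε > 0, ∀ᶠ t in nhds t₀, ∀ a : alg n,
      ‖ω ⟨flow t a, (flow_mem_iff t n a).2 a.2⟩ - ω ⟨flow t₀ a, (flow_mem_iff t₀ n a).2 a.2⟩‖
        ≤ ε * ‖(a : A)‖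

namespace AtomicFlowSequence

variable {A : Type*} [CStarAlgebra A] {H : ℕ → Type*}
  [∀ n, NormedAddCommGroup (H n)] [∀ n, InnerProductSpace ℂ (H n)] [∀ n, CompleteSpace (H n)]
  (D : AtomicFlowSequence A H)

/-- The `σ`-weak topology of the `W⋆`-algebra `Aₙ`. -/
@[reducible] def sigmaWeak (n : ℕ) : TopologicalSpace (D.alg n) :=
  TopologicalSpace.induced (D.rep n) (sigmaWeakTopology (H n))

/-- The restricted flow `αₙᵗ` on `Aₙ`. -/
def flowOn (n : ℕ) (t : ℝ) (a : D.alg n) : D.alg n :=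
  ⟨D.flow t a, (D.flow_mem_iff t n a).2 a.2⟩

/-- The center `𝒵(Aₙ)`. -/
abbrev Z (n : ℕ) : Type _ := Subalgebra.center ℂ (D.alg n)

/-- The `σ`-weak topology of `𝒵(Aₙ)` (the relative one). -/
@[reducible] def sigmaWeakZ (n : ℕ) : TopologicalSpace (D.Z n) :=
  TopologicalSpace.induced (Subtype.val : D.Z n → D.alg n) (D.sigmaWeak n)

/-- The set `𝔷ₙ` of minimal projections of the center `𝒵(Aₙ)`, as elements of `𝒵(Aₙ)`. -/
def minZ (n : ℕ) : Set (D.Z n) := {z | IsMinimalCentralProjection (z : D.alg n)}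

/-- `τ` is a normal `(α_zᵗ, β)`-KMS state on `z Aₙ`, where functionals on `z Aₙ` are regarded as
functionals `τ` on `Aₙ` with `τ(a) = τ(z a)`. The KMS condition reads: for all `a, b ∈ z Aₙ`
there is a bounded continuous function `F` on the closed strip between `Im w = 0` and `Im w = β`,
holomorphic inside, with `F(t) = τ(b αᵗ(a))` and `F(t + iβ) = τ(αᵗ(a) b)`. -/
structure IsNormalKMSState (β : ℝ) (n : ℕ) (z : D.Z n) (τ : D.alg n →ₗ[ℂ] ℂ) : Prop where
  supported : ∀ a, τ (z * a) = τ a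
  nonneg : ∀ a, 0 ≤ τ (star a * a)
  map_unit : τ z = 1
  normal : Continuous[D.sigmaWeak n, inferInstance] τ
  kms : ∀ a b : D.alg n, z * a = a → z * b = b → ∃ F : ℂ → ℂ,
    ContinuousOn F {w | w.im ∈ Set.uIcc 0 β} ∧
    (∃ C : ℝ, ∀ w : ℂ, w.im ∈ Set.uIcc 0 β → ‖F w‖ ≤ C) ∧
    DifferentiableOn ℂ F {w | w.im ∈ Set.uIoo 0 β} ∧
    (∀ t : ℝ, F t = τ (b * D.flowOn n t a)) ∧
    ∀ t : ℝ, F (t + β * Complex.I) = τ (D.flowOn n t a * b)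

/-- The standing requirement on the inverse temperature `β`: for every `n` and every `z ∈ 𝔷ₙ`
there is a unique normal `(α_zᵗ, β)`-KMS state on `z Aₙ`. -/
def HasUniqueKMSStates (β : ℝ) : Prop :=
  ∀ n, ∀ z ∈ D.minZ n, ∃! τ : D.alg n →ₗ[ℂ] ℂ, D.IsNormalKMSState β n z τ

/-- The normal KMS state `τ_z` on `z Aₙ`. -/
def tau (β : ℝ) (n : ℕ) (z : D.Z n) : D.alg n →ₗ[ℂ] ℂ :=
  Classical.epsilon fun τ => D.IsNormalKMSState β n z τ

/-- `E(a) = ∑_{z ∈ 𝔷ₙ} τ_z(z a) z` for all `a ∈ Aₙ`, the sum converging `σ`-weakly. -/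
def IsKMSExpectation (β : ℝ) (n : ℕ) (E : D.alg n →ₗ[ℂ] D.Z n) : Prop :=
  ∀ a : D.alg n,
    @HasSum (D.Z n) (D.minZ n) _ (D.sigmaWeakZ n)
      (fun z => D.tau β n z ((z : D.Z n) * a) • (z : D.Z n)) (E a) (SummationFilter.unconditional _)

/-- The conditional expectation `Eₙ : Aₙ → 𝒵(Aₙ)`, the map given by
`Eₙ(a) = ∑_{z ∈ 𝔷ₙ} τ_z(z a) z`. -/
def E (β : ℝ) (n : ℕ) : D.alg n →ₗ[ℂ] D.Z n :=
  Classical.epsilon fun E => D.IsKMSExpectation β n E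

/-- The map `Θₙ₊₁,ₙ : 𝒵(Aₙ) → 𝒵(Aₙ₊₁)`, the restriction of `Eₙ₊₁`. -/
def thetaStep (β : ℝ) (n : ℕ) : D.Z n →ₗ[ℂ] D.Z (n + 1) :=
  D.E β (n + 1) ∘ₗ
    (StarSubalgebra.inclusion (D.alg_mono (Nat.le_succ n))).toAlgHom.toLinearMap ∘ₗ
      (Subalgebra.center ℂ (D.alg n)).val.toLinearMap

/-- The composition `Θₙ,ₘ = Θₙ,ₙ₋₁ ∘ ⋯ ∘ Θₘ₊₁,ₘ`. -/
def theta (β : ℝ) (m n : ℕ) (h : m ≤ n) : D.Z m →ₗ[ℂ] D.Z n :=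
  Nat.leRec (motive := fun n _ => D.Z m →ₗ[ℂ] D.Z n) LinearMap.id
    (fun k _ f => D.thetaStep β k ∘ₗ f) h

/-! ### The representation systems -/

/-- The (underlying vector space of the) representation system `S̈(αᵗ, β)`: the inductive limit of
`𝒵(A₀) → 𝒵(A₁) → ⋯`. (The inductive limit of matrix ordered `*`-vector spaces with matrix order
unit is this inductive limit of vector spaces, equipped with an order structure.) -/
abbrev DdotS (β : ℝ) : Type _ := Module.DirectLimit D.Z (D.theta β)

/-- The canonical map `Θ̈_{∞,n} : 𝒵(Aₙ) → S̈`. -/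
def ddotTheta (β : ℝ) (n : ℕ) : D.Z n →ₗ[ℂ] D.DdotS β :=
  Module.DirectLimit.of ℂ ℕ D.Z (D.theta β) n

/-- The order unit `ë` of `S̈`. -/
def ddotE (β : ℝ) : D.DdotS β := D.ddotTheta β 0 1

/-- The positive cone of `S̈`: the images of the positive elements of the `𝒵(Aₙ)`. -/
def ddotCone (β : ℝ) : Set (D.DdotS β) :=
  {s | ∃ (n : ℕ) (f : D.Z n),
    (∃ g : D.alg n, (f : D.alg n) = star g * g) ∧ s = D.ddotTheta β n f}

/-- A state on the ordered space `S̈` with order unit `ë`. -/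
def IsStateDdotS (β : ℝ) (φ : D.DdotS β →ₗ[ℂ] ℂ) : Prop :=
  (∀ s ∈ D.ddotCone β, 0 ≤ φ s) ∧ φ (D.ddotE β) = 1

/-- The kernel of the Archimedeanization of `S̈`: the elements on which all states vanish. -/
def archKernel (β : ℝ) : Submodule ℂ (D.DdotS β) :=
  ⨅ φ : {φ : D.DdotS β →ₗ[ℂ] ℂ // D.IsStateDdotS β φ}, LinearMap.ker φ.1

/-- The (underlying vector space of the) representation operator system `S(αᵗ, β)`, the
Archimedeanization of `S̈(αᵗ, β)`. -/
abbrev S (β : ℝ) : Type _ := D.DdotS β ⧸ D.archKernel β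

/-- The canonical map `Θ_{∞,n} : 𝒵(Aₙ) → S`. -/
def ThetaInf (β : ℝ) (n : ℕ) : D.Z n →ₗ[ℂ] D.S β :=
  (D.archKernel β).mkQ ∘ₗ D.ddotTheta β n

/-- The order unit `e` of `S`. -/
def unitS (β : ℝ) : D.S β := (D.archKernel β).mkQ (D.ddotE β)

/-! ### The direct sum of the centers -/

/-- The algebraic direct sum `Σ = ⨁ₙ 𝒵(Aₙ)`. -/
abbrev Sig : Type _ := DirectSum ℕ D.Z

/-- The inclusion `𝒵(Aₙ) → Σ`. -/
def inSig (n : ℕ) : D.Z n →ₗ[ℂ] D.Sig := DirectSum.lof ℂ ℕ D.Z n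

/-- The unit `1ₙ` of `𝒵(Aₙ)`, considered as an element of `Σ`. -/
def oneSig (n : ℕ) : D.Sig := D.inSig n 1

/-- The topology on `Σ` induced from the product of the `σ`-weak topologies on `∏ₙ 𝒵(Aₙ)`. -/
@[reducible] def topSig : TopologicalSpace D.Sig :=
  TopologicalSpace.induced (fun (x : D.Sig) (n : ℕ) => x n)
    (@Pi.topologicalSpace ℕ D.Z D.sigmaWeakZ)

/-! ### Left multiplicative structures -/

/-- The `W⋆`-tensor product `Aₘ ⊗̄ Aₙ`. -/
def tensor (m n : ℕ) : StarSubalgebra ℂ (HilbertTensor (H m) (H n) →L[ℂ] HilbertTensor (H m) (H n)) :=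
  vnTensor (Set.range (D.rep m)) (Set.range (D.rep n))

/-- The elementary tensor `a ⊗ b ∈ Aₘ ⊗̄ Aₙ`. -/
def tmul {m n : ℕ} (a : D.alg m) (b : D.alg n) : D.tensor m n :=
  ⟨opTensor (D.rep m a) (D.rep n b), opTensor_mem_vnTensor ⟨a, rfl⟩ ⟨b, rfl⟩⟩

/-- The `σ`-weak topology on `Aₘ ⊗̄ Aₙ`. -/
@[reducible] def sigmaWeakTensor (m n : ℕ) : TopologicalSpace (D.tensor m n) :=
  TopologicalSpace.induced Subtype.val (sigmaWeakTopology (HilbertTensor (H m) (H n)))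

/-- A left multiplicative structure: normal injective `*`-homomorphisms
`ι_{m,n} : Aₘ ⊗̄ Aₙ → Aₘ₊ₙ` satisfying (m1), (m2), (m3) and (L). The identities (m2) and (m3)
between normal maps are stated on elementary tensors, whose span is `σ`-weakly dense. All
identities are compared inside `A`. -/
structure LeftMultiplicativeStructure where
  /-- the maps `ι_{m,n}` -/
  iota : ∀ m n, D.tensor m n →⋆ₙₐ[ℂ] D.alg (m + n)
  injective : ∀ m n, Function.Injective (iota m n)
  normal : ∀ m n, Continuous[D.sigmaWeakTensor m n, D.sigmaWeak (m + n)] (iota m n)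
  zero_left : ∀ (n : ℕ) (c : ℂ) (a : D.alg n),
    (iota 0 n (D.tmul (algebraMap ℂ (D.alg 0) c) a) : A) = c • (a : A)
  zero_right : ∀ (m : ℕ) (a : D.alg m) (c : ℂ),
    (iota m 0 (D.tmul a (algebraMap ℂ (D.alg 0) c)) : A) = c • (a : A)
  assoc : ∀ (l m n : ℕ) (a : D.alg l) (b : D.alg m) (c : D.alg n),
    (iota (l + m) n (D.tmul (iota l m (D.tmul a b)) c) : A) =
      iota l (m + n) (D.tmul a (iota m n (D.tmul b c)))
  flow : ∀ (m n : ℕ) (t : ℝ) (a : D.alg m) (b : D.alg n),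
    iota m n (D.tmul (D.flowOn m t a) (D.flowOn n t b)) =
      D.flowOn (m + n) t (iota m n (D.tmul a b))
  left : ∀ (n : ℕ) (a : D.alg n), (iota n 1 (D.tmul a 1) : A) = a

/-- The element `Eₘ₊ₙ(ι_{m,n}(f ⊗ g))` of `𝒵(Aₘ₊ₙ)` for `f ∈ 𝒵(Aₘ)` and `g ∈ 𝒵(Aₙ)`. -/
def prodZ {D : AtomicFlowSequence A H} (I : D.LeftMultiplicativeStructure) (β : ℝ) {m n : ℕ}
    (f : D.Z m) (g : D.Z n) : D.Z (m + n) :=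
  D.E β (m + n) (I.iota m n (D.tmul (f : D.alg m) (g : D.alg n)))

end AtomicFlowSequence

end

noncomputable section

/-! ### Amplifications and `σ`-weakly continuous functionals -/

section Amplification

/-! Everything rests on the absorption identity `E(ι(E(a) ⊗ b)) = E(ι(a ⊗ b))` and its mirror image
(`E_ten_E_left`, `E_ten_E_right`). Fix a minimal central projection `z` of `Aₘ₊ₙ` and a square `h⋆h`
in `Aₙ`. By (m3) the functional `a ↦ τ_z(ι(a ⊗ h⋆h))` is again positive, normal and `β`-KMS, now on
`Aₘ`. Every such functional `φ` satisfies `φ ∘ Eₘ = φ` (`IsNormalKMSFunctional.apply_E`): uniqueness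
forces `φ(w a) = φ(w) τ_w(a)` for each minimal central projection `w`, and these `w` sum to `1`
because `Aₘ` is atomic. Squares span `Aₙ`, and the states `τ_z` determine `Eₘ₊ₙ`, so the identity
follows.

Associativity of the product is then (m2), and the unit laws are (m1) together with the fact that
`Eₙ` is the identity on the center (`E_coe`). Condition (L) says that right multiplication by `1₁`
is the connecting map `Θ`. Hence associativity with last factor `1₁` reads `f · Θ(g) = Θ(f · g)`,
which is exactly what makes the action on the inductive limit well defined. Since `S̈` is the direct
sum of the centers modulo all `Θ(f) - f = f · (1₁ - 1₀)`, it is the quotient of `Σ` by the left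
ideal generated by `1₁ - 1₀`.

For `S` the point is positivity: positive central elements act on `S̈` by maps preserving the cone,
so they pull states back to positive functionals, and the kernel of the Archimedeanization is
invariant.

The analytic input concerns normality. Positive normal functionals are vector functionals of an
amplification (`exists_vector_of_continuous_of_nonneg`), so `ℓ¹`-combinations of normal states are
normal (`continuous_tsum_mul`). This makes `Eₙ` normal, since `φ ∘ Eₙ = ∑ φ(z) τ_z` with absolutely
summable coefficients; with normality of `ι` it gives separate continuity. -/

theorem memℓp_two_iff_summable {ι H : Type*} [NormedAddCommGroup H] {ξ : ι → H} : Memℓp ξ 2 ↔ Summable fun i => ‖ξ i‖ ^ 2 := by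
  rw [memℓp_gen_iff (by norm_num)]
  simp

variable {ι H : Type*} [NormedAddCommGroup H] [InnerProductSpace ℂ H]

/-- The amplification `x ⊗ 1` of an operator `x`, acting on `ℓ²(ι, H)`. -/
def ampL (ι : Type*) (x : H →L[ℂ] H) : lp (fun _ : ι => H) 2 →L[ℂ] lp (fun _ : ι => H) 2 :=
  lp.mapCLM 2 (fun _ => x) (norm_nonneg x) fun _ => le_rfl

@[simp]
theorem ampL_apply (x : H →L[ℂ] H) (ξ : lp (fun _ : ι => H) 2) (i : ι) :
    ampL ι x ξ i = x (ξ i) := rfl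

theorem norm_ampL_le (x : H →L[ℂ] H) : ‖ampL ι x‖ ≤ ‖x‖ :=
  lp.norm_mapCLM_le _ _ _ _

theorem ampL_mul (x y : H →L[ℂ] H) : ampL ι (x * y) = ampL ι x * ampL ι y := by
  ext; simp

theorem ampL_add (x y : H →L[ℂ] H) : ampL ι (x + y) = ampL ι x + ampL ι y := by
  ext; simp

theorem ampL_smul (c : ℂ) (x : H →L[ℂ] H) : ampL ι (c • x) = c • ampL ι x := by
  ext; simp

theorem ampL_one : ampL ι (1 : H →L[ℂ] H) = 1 := by
  ext; simp

variable [CompleteSpace H]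

theorem inner_ampL_star_left (x : H →L[ℂ] H) (ξ η : lp (fun _ : ι => H) 2) :
    inner ℂ (ampL ι (star x) ξ) η = inner ℂ ξ (ampL ι x η) := by
  simp only [lp.inner_eq_tsum, ampL_apply, ContinuousLinearMap.star_eq_adjoint,
    ContinuousLinearMap.adjoint_inner_left]

theorem ampL_star (x : H →L[ℂ] H) : ampL ι (star x) = star (ampL ι x) := by
  rw [ContinuousLinearMap.star_eq_adjoint (ampL ι x), ContinuousLinearMap.eq_adjoint_iff]
  exact fun ξ η => inner_ampL_star_left x ξ η

end Amplification

section SigmaWeak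

variable {ι H : Type*} [NormedAddCommGroup H] [InnerProductSpace ℂ H]

theorem continuous_sigmaWeak_inner_nat (ξ η : lp (fun _ : ℕ => H) 2) :
    Continuous[sigmaWeakTopology H, inferInstance] fun x => inner ℂ ξ (ampL ℕ x η) := by
  simp only [lp.inner_eq_tsum, ampL_apply]
  exact continuous_iInf_dom (i := (ξ, η)) continuous_induced_dom

theorem continuous_sigmaWeak_rng_iff {X : Type*} {t : TopologicalSpace X} {f : X → H →L[ℂ] H} :
    Continuous[t, sigmaWeakTopology H] f ↔
      ∀ ξ η : lp (fun _ : ℕ => H) 2, Continuous fun a => inner ℂ ξ (ampL ℕ (f a) η) := by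
  simp only [lp.inner_eq_tsum, ampL_apply]
  rw [continuous_iInf_rng]
  simp only [continuous_induced_rng, Prod.forall, Function.comp_def]

/-- An injection of `ι` into `ℕ` and extension by zero bring any countable family to the index set
used in the definition of the `σ`-weak topology. -/
theorem exists_lp_extend [Countable ι] (ξ η : lp (fun _ : ι => H) 2) :
    ∃ ξ' η' : lp (fun _ : ℕ => H) 2, ∀ x : H →L[ℂ] H,
      inner ℂ ξ (ampL ι x η) = inner ℂ ξ' (ampL ℕ x η') := by
  obtain ⟨e, he⟩ := exists_injective_nat ι
  have key : ∀ ζ : lp (fun _ : ι => H) 2, Memℓp (Function.extend e ζ 0) 2 := fun ζ => by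
    rw [memℓp_two_iff_summable]
    refine (he.summable_iff fun n hn => ?_).1 ?_
    · rw [Function.extend_apply' _ _ _ (by simpa using hn)]; simp
    · simpa [Function.comp_def, he.extend_apply] using memℓp_two_iff_summable.1 ζ.2
  refine ⟨⟨_, key ξ⟩, ⟨_, key η⟩, fun x => ?_⟩
  simp only [lp.inner_eq_tsum, ampL_apply]
  rw [← he.tsum_eq]
  · simp [he.extend_apply]
  · intro n hn
    by_contra h
    exact hn (by simp [Function.extend_apply' _ _ _ (by simpa using h)])

/-- A square-summable family has countable support, which reduces to the countable case. Arbitrary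
index sets matter later, when vectors are assembled over disjoint unions and Hilbert bases. -/
theorem continuous_sigmaWeak_inner (ξ η : lp (fun _ : ι => H) 2) :
    Continuous[sigmaWeakTopology H, inferInstance] fun x => inner ℂ ξ (ampL ι x η) := by
  set s : Set ι := Function.support fun i => ‖η i‖ ^ 2 with hs
  have hsc : Countable s := (memℓp_two_iff_summable.1 η.2).countable_support
  have key : ∀ ζ : lp (fun _ : ι => H) 2, Memℓp (fun i : s => ζ i) 2 := fun ζ => by
    rw [memℓp_two_iff_summable]
    exact (memℓp_two_iff_summable.1 ζ.2).subtype s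
  obtain ⟨ξ', η', h⟩ := exists_lp_extend (⟨_, key ξ⟩ : lp (fun _ : s => H) 2) ⟨_, key η⟩
  convert! continuous_sigmaWeak_inner_nat ξ' η' using 2 with x
  rw [← h]
  simp only [lp.inner_eq_tsum, ampL_apply]
  refine (tsum_subtype_eq_of_support_subset fun i hi => ?_).symm
  simp only [hs, Function.mem_support] at hi ⊢
  contrapose! hi
  have : η i = 0 := by simpa using hi
  simp [this]

theorem isTopologicalAddGroup_sigmaWeak :
    @IsTopologicalAddGroup (H →L[ℂ] H) (sigmaWeakTopology H) _ := by
  have : sigmaWeakTopology H = ⨅ p : lp (fun _ : ℕ => H) 2 × lp (fun _ : ℕ => H) 2,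
    TopologicalSpace.induced (AddMonoidHom.mk' (fun x : H →L[ℂ] H => inner ℂ p.1 (ampL ℕ x p.2))
      fun x y => by rw [ampL_add]; simp) inferInstance := by
    simp [sigmaWeakTopology, lp.inner_eq_tsum]
  rw [this]
  exact topologicalAddGroup_iInf fun _ => topologicalAddGroup_induced _

theorem continuous_sigmaWeak_inner_vec (u v : H) :
    Continuous[sigmaWeakTopology H, inferInstance] fun x : H →L[ℂ] H => inner ℂ u (x v) := by
  classical
  convert! continuous_sigmaWeak_inner (ι := Unit) (lp.single 2 () u) (lp.single 2 () v) using 2 with x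
  simp [lp.inner_eq_tsum]

theorem t2Space_sigmaWeak : @T2Space (H →L[ℂ] H) (sigmaWeakTopology H) := by
  let _ := sigmaWeakTopology H
  refine T2Space.of_injective_continuous
    (f := fun (x : H →L[ℂ] H) (p : H × H) => inner ℂ p.1 (x p.2)) (fun x y h => ?_) ?_
  · ext v
    exact ext_inner_left ℂ fun u => congrFun h (u, v)
  · exact continuous_pi fun p => continuous_sigmaWeak_inner_vec p.1 p.2

theorem continuous_sigmaWeak_mul_left [CompleteSpace H] (y : H →L[ℂ] H) :
    Continuous[sigmaWeakTopology H, sigmaWeakTopology H] fun x => y * x := by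
  refine continuous_sigmaWeak_rng_iff.2 fun ξ η => ?_
  convert continuous_sigmaWeak_inner_nat (ampL ℕ (star y) ξ) η using 2 with x
  rw [inner_ampL_star_left, ampL_mul]; rfl

theorem continuous_sigmaWeak_mul_right (y : H →L[ℂ] H) :
    Continuous[sigmaWeakTopology H, sigmaWeakTopology H] fun x => x * y := by
  refine continuous_sigmaWeak_rng_iff.2 fun ξ η => ?_
  convert continuous_sigmaWeak_inner_nat ξ (ampL ℕ y η) using 2 with x
  rw [ampL_mul]; rfl

end SigmaWeak

/-! ### Positive functionals and vector functionals -/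

section PositiveFunctional

variable {R : Type*} [Ring R] [StarRing R] [Algebra ℂ R] [StarModule ℂ R]

/-- Positivity makes the values of `τ` on the squares of `1 + a` and `1 + i a` real. The vanishing
of the two imaginary parts gives the two components of the identity. -/
theorem map_star_of_nonneg {τ : R →ₗ[ℂ] ℂ} (hτ : ∀ a, 0 ≤ τ (star a * a)) (a : R) :
    τ (star a) = star (τ a) := by
  have im0 : ∀ a, (τ (star a * a)).im = 0 := fun a => ((Complex.nonneg_iff.1 (hτ a)).2).symm
  have e1 : τ (star (1 + a) * (1 + a)) = τ (star 1 * 1) + τ (star a) + τ a + τ (star a * a) := by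
    simp only [← map_add]; congr 1; simp; noncomm_ring
  have e2 : τ (star (1 + Complex.I • a) * (1 + Complex.I • a)) =
      τ (star 1 * 1) + (Complex.I * τ a - Complex.I * τ (star a)) + τ (star a * a) := by
    simp only [← map_add, ← smul_eq_mul, ← map_smul, ← map_sub]
    congr 1
    simp [add_mul, mul_add, smul_smul]; abel
  have h1 := congrArg Complex.im e1
  have h2 := congrArg Complex.im e2
  simp only [im0, Complex.add_im, Complex.sub_im, Complex.mul_im, Complex.I_re, Complex.I_im] at h1 h2
  apply Complex.ext <;> simp <;> linarith

/-- Cauchy–Schwarz for the semi-definite form `(a, b) ↦ τ(a⋆b)`. -/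
theorem norm_map_star_mul_le {τ : R →ₗ[ℂ] ℂ} (hτ : ∀ a, 0 ≤ τ (star a * a)) (a b : R) :
    ‖τ (star a * b)‖ ^ 2 ≤ (τ (star a * a)).re * (τ (star b * b)).re := by
  let c : PreInnerProductSpace.Core ℂ R :=
    { inner := fun a b => τ (star a * b)
      conj_inner_symm := fun x y => by
        rw [← RCLike.star_def, ← map_star_of_nonneg hτ]; simp
      re_inner_nonneg := fun x => (Complex.nonneg_iff.1 (hτ x)).1
      add_left := fun x y z => by simp [add_mul]
      smul_left := fun x y r => by simp }
  have h := @InnerProductSpace.Core.inner_mul_inner_self_le ℂ R _ _ _ c a b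
  have h2 : ‖τ (star b * a)‖ = ‖τ (star a * b)‖ := by
    have := map_star_of_nonneg hτ (star a * b)
    simp only [star_mul, star_star] at this
    rw [this, norm_star]
  have h' : ‖τ (star a * b)‖ * ‖τ (star b * a)‖ ≤ (τ (star a * a)).re * (τ (star b * b)).re := h
  rwa [h2, ← sq] at h'

theorem exists_selfAdjoint_sq {K : Type*} [NormedAddCommGroup K] [InnerProductSpace ℂ K]
    [CompleteSpace K] {T : K →L[ℂ] K} (hT : 0 ≤ T) :
    ∃ S : K →L[ℂ] K, IsSelfAdjoint S ∧ S * S = T ∧ ∀ x, Commute T x → Commute S x := by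
  refine ⟨CFC.sqrt T, (CFC.sqrt_nonneg T).isSelfAdjoint, CFC.sqrt_mul_sqrt_self T, fun x hx => ?_⟩
  rw [CFC.sqrt_eq_cfc]
  exact hx.cfc_nnreal _

/-- A Radon–Nikodym argument. On the closed cyclic subspace of `ζ`, domination yields a positive
operator `T` with `τ(b⋆a) = ⟪T ρ(b)ζ, ρ(a)ζ⟫`. It commutes with the representation, and so does its
square root `S`; the vector sought is `S ζ`. -/
theorem exists_vector_of_le {K : Type*} [NormedAddCommGroup K] [InnerProductSpace ℂ K]
    [CompleteSpace K] (ρ : R →⋆ₐ[ℂ] (K →L[ℂ] K)) (ζ : K) {τ : R →ₗ[ℂ] ℂ}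
    (hτ : ∀ a, 0 ≤ τ (star a * a)) (hle : ∀ a, (τ (star a * a)).re ≤ ‖ρ a ζ‖ ^ 2) :
    ∃ ζ' : K, ∀ a, τ a = inner ℂ ζ' (ρ a ζ') := by
  let e : R →ₗ[ℂ] K :=
    { toFun := fun a => ρ a ζ
      map_add' := fun a b => by simp
      map_smul' := fun c a => by simp }
  let K₀ : Submodule ℂ K := (LinearMap.range e).topologicalClosure
  have hcl : IsClosed (K₀ : Set K) := Submodule.isClosed_topologicalClosure _
  have : CompleteSpace K₀ := hcl.completeSpace_coe
  let e₀ : R →ₗ[ℂ] K₀ :=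
    e.codRestrict K₀ fun a => Submodule.le_topologicalClosure _ (LinearMap.mem_range_self e a)
  have hd : DenseRange e₀ := by
    intro x
    rw [closure_subtype]
    refine closure_mono ?_ (show (x : K) ∈ closure (LinearMap.range e : Set K) from x.2)
    rintro _ ⟨a, rfl⟩
    exact ⟨e₀ a, ⟨a, rfl⟩, rfl⟩
  have hbd : ∀ b a, ‖τ (star b * a)‖ ≤ ‖e₀ b‖ * ‖e₀ a‖ := fun b a => by
    refine le_of_sq_le_sq ?_ (by positivity)
    rw [mul_pow]
    exact (norm_map_star_mul_le hτ b a).trans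
      (mul_le_mul (hle b) (hle a) (Complex.nonneg_iff.1 (hτ a)).1 (by positivity))
  let f : R → R →ₗ[ℂ] ℂ := fun b => τ ∘ₗ LinearMap.mulLeft ℂ (star b)
  have hf : ∀ b a, (f b).extendOfNorm e₀ (e₀ a) = τ (star b * a) := fun b a =>
    LinearMap.extendOfNorm_eq hd ⟨_, hbd b⟩ a
  have hfn : ∀ b, ‖(f b).extendOfNorm e₀‖ ≤ ‖e₀ b‖ := fun b =>
    LinearMap.opNorm_extendOfNorm_le hd (norm_nonneg _) (hbd b)
  let g' : R → K₀ := fun b => (InnerProductSpace.toDual ℂ K₀).symm ((f b).extendOfNorm e₀)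
  have hg' : ∀ b a, inner ℂ (g' b) (e₀ a) = τ (star b * a) := fun b a => by
    rw [← hf, InnerProductSpace.toDual_symm_apply]
  have hext : ∀ u v : K₀, (∀ a, inner ℂ u (e₀ a) = inner ℂ v (e₀ a)) → u = v := fun u v h =>
    ext_inner_right ℂ fun w => by
      refine hd.induction_on (p := fun w => inner ℂ u w = inner ℂ v w) w ?_ h
      exact isClosed_eq (by fun_prop) (by fun_prop)
  -- The Riesz map is conjugate linear, and so is `b ↦ τ(b⋆ ·)`; the composite is therefore linear.
  let g : R →ₗ[ℂ] K₀ :=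
    { toFun := g'
      map_add' := fun a b => hext _ _ fun c => by
        rw [inner_add_left, hg', hg', hg', star_add, add_mul, map_add]
      map_smul' := fun c a => hext _ _ fun b => by
        rw [inner_smul_left, hg', hg']; simp }
  have hgn : ∀ b, ‖g b‖ ≤ 1 * ‖e₀ b‖ := fun b => by
    rw [one_mul]
    calc ‖g b‖ = ‖(f b).extendOfNorm e₀‖ :=
          (InnerProductSpace.toDual ℂ K₀).symm.norm_map ((f b).extendOfNorm e₀)
      _ ≤ ‖e₀ b‖ := hfn b
  let T : K₀ →L[ℂ] K₀ := g.extendOfNorm e₀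
  have hT : ∀ b a, inner ℂ (T (e₀ b)) (e₀ a) = τ (star b * a) := fun b a => by
    rw [show T (e₀ b) = g b from LinearMap.extendOfNorm_eq hd ⟨1, hgn⟩ b]
    exact hg' b a
  have hTpos : 0 ≤ T := by
    rw [ContinuousLinearMap.nonneg_iff_isPositive, ContinuousLinearMap.isPositive_iff_complex]
    have : ∀ x, 0 ≤ inner ℂ (T x) x := fun x => by
      refine hd.induction_on (p := fun x => 0 ≤ inner ℂ (T x) x) x ?_ fun a => ?_
      · exact isClosed_le continuous_const (by fun_prop)
      · rw [hT]; exact hτ a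
    intro x
    obtain ⟨h1, h2⟩ := Complex.nonneg_iff.1 (this x)
    exact ⟨Complex.ext (Complex.ofReal_re _) ((Complex.ofReal_im _).trans h2), h1⟩
  have hinv : ∀ c, ∀ x ∈ K₀, ρ c x ∈ K₀ := fun c x hx => by
    refine map_mem_closure (ρ c).continuous hx ?_
    rintro _ ⟨a, rfl⟩
    exact ⟨c * a, by simp [e]⟩
  let ρ₀ : R → K₀ →L[ℂ] K₀ := fun c =>
    ((ρ c).comp K₀.subtypeL).codRestrict K₀ fun x => hinv c x x.2
  have hρe : ∀ c a, ρ₀ c (e₀ a) = e₀ (c * a) := fun c a => Subtype.ext (by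
    change ρ c (ρ a ζ) = ρ (c * a) ζ
    simp)
  have hρstar : ∀ c (x y : K₀), inner ℂ (ρ₀ c x) y = inner ℂ x (ρ₀ (star c) y) := fun c x y => by
    change inner ℂ (ρ c x) (y : K) = inner ℂ (x : K) (ρ (star c) y)
    rw [map_star, ContinuousLinearMap.star_eq_adjoint, ContinuousLinearMap.adjoint_inner_right]
  have hcomm : ∀ c, Commute T (ρ₀ c) := fun c => by
    refine ContinuousLinearMap.ext fun x => ?_
    refine hd.induction_on (p := fun x => (T * ρ₀ c) x = (ρ₀ c * T) x) x ?_ fun b => ?_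
    · exact isClosed_eq (by fun_prop) (by fun_prop)
    · refine hext _ _ fun a => ?_
      simp only [mul_apply_eq_comp]
      rw [hρe, hT, hρstar, hρe, hT]
      simp [mul_assoc]
  obtain ⟨S, hSsa, hSS, hSc⟩ := exists_selfAdjoint_sq hTpos
  have hScomm : ∀ c, Commute S (ρ₀ c) := fun c => hSc _ (hcomm c)
  refine ⟨S (e₀ 1), fun a => ?_⟩
  have h1 : (ρ a) (S (e₀ 1) : K) = (ρ₀ a * S) (e₀ 1) := rfl
  rw [h1, ← (hScomm a).eq, ← Submodule.coe_inner, mul_apply_eq_comp, hρe, mul_one]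
  have h2 : inner ℂ (S (e₀ 1)) (S (e₀ a)) = inner ℂ (S (S (e₀ 1))) (e₀ a) := by
    conv_rhs => rw [← hSsa.adjoint_eq, ContinuousLinearMap.adjoint_inner_left, hSsa.adjoint_eq]
  rw [h2, ← mul_apply_eq_comp, hSS, hT]
  simp

end PositiveFunctional

/-! ### Normal functionals as vector functionals of amplifications -/

section Normal

variable {R : Type*} [Ring R] [StarRing R] [Algebra ℂ R]
  {H : Type*} [NormedAddCommGroup H] [InnerProductSpace ℂ H] [CompleteSpace H]

/-- The amplification of a representation. -/
def ampRep (ι : Type*) (π : R →⋆ₐ[ℂ] (H →L[ℂ] H)) :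
    R →⋆ₐ[ℂ] (lp (fun _ : ι => H) 2 →L[ℂ] lp (fun _ : ι => H) 2) where
  toFun a := ampL ι (π a)
  map_one' := by simp [ampL_one]
  map_mul' a b := by simp [ampL_mul]
  map_zero' := by ext; simp
  map_add' a b := by simp [ampL_add]
  commutes' c := by
    rw [Algebra.algebraMap_eq_smul_one, Algebra.algebraMap_eq_smul_one, map_smul, map_one,
      ampL_smul, ampL_one]
  map_star' a := by rw [map_star, ampL_star]

theorem ampRep_apply (ι : Type*) (π : R →⋆ₐ[ℂ] (H →L[ℂ] H)) (a : R) :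
    ampRep ι π a = ampL ι (π a) := rfl

/-- Pull back of a vector functional of an amplification to the represented algebra. -/
def vecFunctional {ι : Type*} (π : R →⋆ₐ[ℂ] (H →L[ℂ] H)) (ξ η : lp (fun _ : ι => H) 2) :
    R →ₗ[ℂ] ℂ where
  toFun a := inner ℂ ξ (ampL ι (π a) η)
  map_add' a b := by simp [ampL_add]
  map_smul' c a := by simp [ampL_smul]

theorem exists_lp_sumElim {ι κ H : Type*} [NormedAddCommGroup H] (ξ : lp (fun _ : ι => H) 2) (ξ' : lp (fun _ : κ => H) 2) :
    ∃ ζ : lp (fun _ : ι ⊕ κ => H) 2, (∀ i, ζ (Sum.inl i) = ξ i) ∧ ∀ j, ζ (Sum.inr j) = ξ' j := by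
  refine ⟨⟨Sum.elim ξ ξ', ?_⟩, fun _ => rfl, fun _ => rfl⟩
  change Memℓp _ 2
  rw [memℓp_two_iff_summable]
  exact Summable.sum _ (memℓp_two_iff_summable.1 ξ.2) (memℓp_two_iff_summable.1 ξ'.2)

/-- A functional continuous for the weak topology of a family of functionals is a finite linear
combination of them. A sum of two vector functionals is a single one over the disjoint union of the
index sets. -/
theorem exists_vectors_of_continuous {π : R →⋆ₐ[ℂ] (H →L[ℂ] H)} {τ : R →ₗ[ℂ] ℂ}
    (hτ : Continuous[TopologicalSpace.induced π (sigmaWeakTopology H), inferInstance] τ) :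
    ∃ (ι : Type) (ξ η : lp (fun _ : ι => H) 2), ∀ a, τ a = inner ℂ ξ (ampL ι (π a) η) := by
  have h : τ ∈ Submodule.span ℂ (Set.range
      fun p : lp (fun _ : ℕ => H) 2 × lp (fun _ : ℕ => H) 2 => vecFunctional π p.1 p.2) := by
    rw [LinearMap.mem_span_iff_continuous]
    convert! hτ using 1
    rw [sigmaWeakTopology, induced_iInf]
    simp only [induced_compose]
    simp [vecFunctional, Function.comp_def, lp.inner_eq_tsum]
  clear hτ
  induction h using Submodule.span_induction with
  | mem x hx =>
    obtain ⟨p, rfl⟩ := hx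
    exact ⟨ℕ, p.1, p.2, fun a => rfl⟩
  | zero => exact ⟨ℕ, 0, 0, fun a => by simp⟩
  | add x y _ _ hx hy =>
    obtain ⟨ι, ξ, η, h⟩ := hx
    obtain ⟨κ, ξ', η', h'⟩ := hy
    obtain ⟨u, hu, hu'⟩ := exists_lp_sumElim ξ ξ'
    obtain ⟨v, hv, hv'⟩ := exists_lp_sumElim η η'
    refine ⟨ι ⊕ κ, u, v, fun a => ?_⟩
    rw [LinearMap.add_apply, h, h']
    refine HasSum.unique (HasSum.sum ?_ ?_) (lp.hasSum_inner (𝕜 := ℂ) u (ampL (ι ⊕ κ) (π a) v))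
    · simpa [Function.comp_def, hu, hv] using lp.hasSum_inner (𝕜 := ℂ) ξ (ampL ι (π a) η)
    · simpa [Function.comp_def, hu', hv'] using lp.hasSum_inner (𝕜 := ℂ) ξ' (ampL κ (π a) η')
  | smul c x _ hx =>
    obtain ⟨ι, ξ, η, h⟩ := hx
    exact ⟨ι, ξ, c • η, fun a => by simp [h]⟩

/-- A positive normal functional is a vector functional of an amplification. -/
theorem exists_vector_of_continuous_of_nonneg [StarModule ℂ R] {π : R →⋆ₐ[ℂ] (H →L[ℂ] H)}
    {τ : R →ₗ[ℂ] ℂ}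
    (hτ : Continuous[TopologicalSpace.induced π (sigmaWeakTopology H), inferInstance] τ)
    (hpos : ∀ a, 0 ≤ τ (star a * a)) :
    ∃ (ι : Type) (ζ : lp (fun _ : ι => H) 2), ∀ a, τ a = inner ℂ ζ (ampL ι (π a) ζ) := by
  obtain ⟨ι, ξ, η, h⟩ := exists_vectors_of_continuous hτ
  -- The dominating vector is `(ξ + η)/2`, because `Re ⟪u, v⟫ = ‖(u + v)/2‖² - ‖(u - v)/2‖²`.
  refine ⟨ι, exists_vector_of_le (ampRep ι π) ((1 / 2 : ℂ) • (ξ + η)) hpos fun a => ?_⟩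
  have h1 : τ (star a * a) = inner ℂ (ampL ι (π a) ξ) (ampL ι (π a) η) := by
    rw [h, map_mul, ampL_mul, map_star, mul_apply_eq_comp, ← inner_ampL_star_left, star_star]
  rw [h1, map_smul, norm_smul, ampRep_apply, map_add]
  set u := ampL ι (π a) ξ
  set v := ampL ι (π a) η
  have h2 := norm_add_sq (𝕜 := ℂ) u v
  have h3 := norm_sub_sq (𝕜 := ℂ) u v
  have h4 : (inner ℂ u v : ℂ).re = RCLike.re (inner ℂ u v) := rfl
  rw [h4, mul_pow]
  norm_num
  nlinarith [sq_nonneg ‖u - v‖]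

end Normal

/-! ### Central projections of a von Neumann algebra -/

section CentralProjection

/-- With `P` the projection onto `V`, invariance under `T` gives `P T P = T P`, and invariance under
the adjoint gives `P T P = P T`. -/
theorem commute_starProjection {H : Type*} [NormedAddCommGroup H] [InnerProductSpace ℂ H]
    [CompleteSpace H] {V : Submodule ℂ H} [V.HasOrthogonalProjection] {T : H →L[ℂ] H}
    (hT : ∀ v ∈ V, T v ∈ V) (hT' : ∀ v ∈ V, star T v ∈ V) : Commute T V.starProjection := by
  have key : ∀ S : H →L[ℂ] H, (∀ v ∈ V, S v ∈ V) →
      V.starProjection * (S * V.starProjection) = S * V.starProjection := fun S hS => by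
    ext x
    exact V.starProjection_eq_self_iff.2 (hS _ (V.starProjection_apply_mem x))
  have hP : star V.starProjection = V.starProjection :=
    (isStarProjection_starProjection (U := V)).isSelfAdjoint
  have h := congrArg star (key _ hT')
  simp only [star_mul, hP, star_star] at h
  rw [Commute, SemiconjBy, ← key T hT, ← mul_assoc, h]

variable {R : Type*} [Ring R] [StarRing R] [Algebra ℂ R]
  {H : Type*} [NormedAddCommGroup H] [InnerProductSpace ℂ H] [CompleteSpace H]
  {π : R →⋆ₐ[ℂ] (H →L[ℂ] H)}

theorem star_mem_centralizer_range {S : H →L[ℂ] H} (hS : S ∈ Set.centralizer (Set.range π)) :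
    star S ∈ Set.centralizer (Set.range π) := by
  rintro _ ⟨a, rfl⟩
  have := congrArg star (hS _ ⟨star a, rfl⟩)
  simpa [map_star] using this.symm

/-- Commuting with the commutant puts `T` in the bicommutant, that is, in the algebra itself;
injectivity of `π` carries centrality back to `R`. -/
theorem exists_central_eq (hinj : Function.Injective π)
    (hbi : Set.centralizer (Set.centralizer (Set.range π)) = Set.range π) {T : H →L[ℂ] H}
    (hT : T ∈ Set.centralizer (Set.range π))
    (hT' : ∀ S ∈ Set.centralizer (Set.range π), Commute S T) :
    ∃ r ∈ Subring.center R, π r = T := by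
  have h : T ∈ Set.range π := by
    rw [← hbi]
    exact fun S hS => hT' S hS
  obtain ⟨r, rfl⟩ := h
  refine ⟨r, Subring.mem_center_iff.2 fun a => hinj ?_, rfl⟩
  simpa using hT _ ⟨a, rfl⟩

/-- The central support of an element. -/
theorem exists_central_support (hinj : Function.Injective π)
    (hbi : Set.centralizer (Set.centralizer (Set.range π)) = Set.range π) (y : R) :
    ∃ p ∈ Subring.center R, IsStarProjection p ∧ p * y = y ∧
      (∀ x ∈ Subring.center R, x * y = 0 → x * p = 0) ∧
      (y ∈ Subring.center R → ∀ ζ, π (star y) ζ = 0 → π p ζ = 0) := by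
  let s : Set H := {w | ∃ a v, w = π a (π y v)}
  -- The closed span of `π(R) π(y) H` is invariant under the algebra and under its commutant, so the
  -- projection onto it is central.
  let V : Submodule ℂ H := (Submodule.span ℂ s).topologicalClosure
  have hcl : IsClosed (V : Set H) := Submodule.isClosed_topologicalClosure _
  have : CompleteSpace V := hcl.completeSpace_coe
  have hsV : ∀ a v, π a (π y v) ∈ V := fun a v =>
    Submodule.le_topologicalClosure _ (Submodule.subset_span ⟨a, v, rfl⟩)
  have hind : ∀ (W : Submodule ℂ H), IsClosed (W : Set H) → (∀ a v, π a (π y v) ∈ W) → V ≤ W := by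
    intro W hW h
    refine Submodule.topologicalClosure_minimal _ (Submodule.span_le.2 ?_) hW
    rintro _ ⟨a, v, rfl⟩
    exact h a v
  have hinv : ∀ T : H →L[ℂ] H, (∀ a v, T (π a (π y v)) ∈ V) → ∀ v ∈ V, T v ∈ V := fun T hT =>
    hind (V.comap T.toLinearMap) (hcl.preimage T.continuous) hT
  have hπ : ∀ b, ∀ v ∈ V, π b v ∈ V := fun b => hinv _ fun a v => by
    rw [← mul_apply_eq_comp, ← map_mul]
    exact hsV _ _
  have hS : ∀ S ∈ Set.centralizer (Set.range π), ∀ v ∈ V, S v ∈ V := fun S hS =>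
    hinv _ fun a v => by
      have h1 : ∀ b w, S (π b w) = π b (S w) := fun b w =>
        (DFunLike.congr_fun (hS _ ⟨b, rfl⟩) w).symm
      rw [h1, h1]
      exact hsV _ _
  obtain ⟨p, hpc, hp⟩ := exists_central_eq hinj hbi (T := V.starProjection)
    (by
      rintro _ ⟨a, rfl⟩
      exact commute_starProjection (hπ a) (by simpa [map_star] using hπ (star a)))
    (fun S h => commute_starProjection (hS S h) (hS _ (star_mem_centralizer_range h)))
  have hproj := isStarProjection_starProjection (U := V)
  refine ⟨p, hpc, ⟨hinj ?_, hinj ?_⟩, hinj ?_, fun x hx hxy => hinj ?_, fun hy ζ hζ => ?_⟩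
  · rw [map_mul, hp, hproj.isIdempotentElem.eq]
  · rw [map_star, hp, hproj.isSelfAdjoint.star_eq]
  · ext v
    rw [map_mul, mul_apply_eq_comp, hp]
    exact V.starProjection_eq_self_iff.2 (by simpa using hsV 1 v)
  · ext v
    rw [map_mul, hp, mul_apply_eq_comp, map_zero]
    refine hind (LinearMap.ker (π x).toLinearMap)
      (ContinuousLinearMap.isClosed_ker (π x)) (fun a v => ?_) (V.starProjection_apply_mem v)
    rw [LinearMap.mem_ker]
    change (π x) (π a (π y v)) = 0
    rw [← mul_apply_eq_comp, ← mul_apply_eq_comp, ← map_mul, ← map_mul,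
      ← Subring.mem_center_iff.1 hx a, mul_assoc, hxy]
    simp
  -- For central `y` the space `V` is the closure of the range of `π y`, whose orthogonal complement
  -- is the kernel of `π (star y)`.
  · rw [hp, Submodule.starProjection_apply_eq_zero_iff, Submodule.mem_orthogonal]
    refine fun u hu => inner_eq_zero_symm.1 ?_
    refine hind (LinearMap.ker (innerSL ℂ ζ).toLinearMap)
      (ContinuousLinearMap.isClosed_ker _) (fun a v => ?_) hu
    rw [LinearMap.mem_ker]
    change inner ℂ ζ (π a (π y v)) = 0
    rw [← mul_apply_eq_comp, ← map_mul, Subring.mem_center_iff.1 hy a, map_mul,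
      mul_apply_eq_comp, ← ContinuousLinearMap.adjoint_inner_left,
      ← ContinuousLinearMap.star_eq_adjoint, ← map_star, hζ, inner_zero_left]

theorem one_sub_mem_center {R : Type*} [Ring R] {r : R} (hr : r ∈ Subring.center R) : 1 - r ∈ Subring.center R :=
  Subring.sub_mem _ (Subring.one_mem _) hr

theorem star_mem_center {R : Type*} [Ring R] [StarRing R] {r : R} (hr : r ∈ Subring.center R) : star r ∈ Subring.center R :=
  Subring.mem_center_iff.2 fun a => by
    simpa using (congrArg star (Subring.mem_center_iff.1 hr (star a))).symm

/-- The central support `z` of a minimal projection `q` is minimal among central projections: a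
central projection `r` below `z` makes `r q` either `0` or `q`, and then `r` is `0` or `z` by the
defining property of the support. -/
theorem exists_isMinimalCentralProjection (hinj : Function.Injective π)
    (hbi : Set.centralizer (Set.centralizer (Set.range π)) = Set.range π)
    (hat : ∀ p : R, IsStarProjection p → p ≠ 0 → ∃ q : R, IsMinimalProjection q ∧ q * p = q)
    {p : R} (hp : IsStarProjection p) (hpc : p ∈ Subring.center R) (hp0 : p ≠ 0) :
    ∃ z : R, IsMinimalCentralProjection z ∧ z * p = z := by
  obtain ⟨q, ⟨hq, hq0, hqm⟩, hqp⟩ := hat p hp hp0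
  obtain ⟨z, hzc, hz, hzq, hzx, -⟩ := exists_central_support hinj hbi q
  have hle : ∀ r ∈ Subring.center R, r * q = q → r * z = z := fun r hr h => by
    have := hzx _ (one_sub_mem_center hr) (by rw [sub_mul, one_mul, h, sub_self])
    rwa [sub_mul, one_mul, sub_eq_zero, eq_comm] at this
  refine ⟨z, ⟨hz, hzc, ?_, fun r hr hrc hrz => ?_⟩, ?_⟩
  · rintro rfl
    exact hq0 (by rw [← hzq, zero_mul])
  · rcases hqm (r * q) (hr.mul hq (Subring.mem_center_iff.1 hrc q).symm)
      (by rw [mul_assoc, hq.isIdempotentElem.eq]) with h | h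
    · exact Or.inl (by rw [← hrz, hzx r hrc h])
    · exact Or.inr (by rw [← hrz, hle r hrc h])
  · rw [Subring.mem_center_iff.1 hpc z]
    exact hle p hpc (by rw [← Subring.mem_center_iff.1 hpc q, hqp])

/-- The product is a central projection below both factors; if it were nonzero, it would be equal to
each of them. -/
theorem IsMinimalCentralProjection.mul_eq_zero {R : Type*} [Ring R] [StarRing R] {z w : R} (hz : IsMinimalCentralProjection z)
    (hw : IsMinimalCentralProjection w) (hne : z ≠ w) : z * w = 0 := by
  have hzw : z * w = w * z := Subring.mem_center_iff.1 hw.2.1 z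
  have hp : IsStarProjection (z * w) := hz.1.mul hw.1 hzw
  have hc : z * w ∈ Subring.center R := Subring.mul_mem _ hz.2.1 hw.2.1
  rcases hz.2.2.2 _ hp hc (by rw [mul_assoc, ← hzw, ← mul_assoc, hz.1.isIdempotentElem.eq]) with h | h
  · exact h
  rcases hw.2.2.2 _ hp hc (by rw [mul_assoc, hw.1.isIdempotentElem.eq]) with h' | h'
  · exact h'
  · exact absurd (h.symm.trans h') hne

/-- A minimal central projection is the support of each nonzero central element below it. -/
theorem IsMinimalCentralProjection.apply_eq_zero (hinj : Function.Injective π)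
    (hbi : Set.centralizer (Set.centralizer (Set.range π)) = Set.range π) {z k : R}
    (hz : IsMinimalCentralProjection z) (hk : k ∈ Subring.center R) (hzk : z * k = k)
    (hk0 : k ≠ 0) {ζ : H} (hζ : π k ζ = 0) : π z ζ = 0 := by
  -- The support is taken of `star k` because the last clause of `exists_central_support` speaks of
  -- the kernel of the adjoint. This support lies below `z` and is nonzero, so minimality makes it
  -- `z`.
  obtain ⟨p, hpc, hp, hpy, hpx, hpζ⟩ := exists_central_support hinj hbi (star k)
  have hzs : z * star k = star k := by
    have := congrArg star hzk
    rwa [star_mul, hz.1.isSelfAdjoint.star_eq, Subring.mem_center_iff.1 hz.2.1] at this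
  have hzp : p * z = p := by
    have := hpx _ (one_sub_mem_center hz.2.1) (by rw [sub_mul, one_mul, hzs, sub_self])
    rw [sub_mul, one_mul, sub_eq_zero] at this
    rw [Subring.mem_center_iff.1 hz.2.1 p, ← this]
  have hpz : p = z := by
    refine (hz.2.2.2 p hp hpc hzp).resolve_left ?_
    rintro rfl
    rw [zero_mul] at hpy
    exact hk0 (star_eq_zero.1 hpy.symm)
  rw [← hpz]
  exact hpζ (star_mem_center hk) ζ (by rwa [star_star])

end CentralProjection

/-! ### Sums of orthogonal projections -/

section OrthogonalSum

/-- Bessel's inequality: a finite sum of mutually orthogonal projections is a projection, hence a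
contraction. -/
theorem sum_norm_sq_le_of_orthogonal {K J : Type*} [NormedAddCommGroup K] [InnerProductSpace ℂ K]
    [CompleteSpace K] {P : J → K →L[ℂ] K} (hP : ∀ j, IsStarProjection (P j))
    (hPP : Pairwise fun i j => P i * P j = 0) (x : K) (s : Finset J) :
    ∑ j ∈ s, ‖P j x‖ ^ 2 ≤ ‖x‖ ^ 2 := by
  classical
  have hQ : IsStarProjection (∑ j ∈ s, P j) := by
    induction s using Finset.induction_on with
    | empty => simp
    | insert a s ha ih =>
      rw [Finset.sum_insert ha]
      refine (hP a).add ih ?_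
      rw [Finset.mul_sum]
      exact Finset.sum_eq_zero fun j hj => hPP (fun h => ha (h ▸ hj))
  have key : ∀ Q : K →L[ℂ] K, IsStarProjection Q → (‖Q x‖ ^ 2 : ℂ) = inner ℂ x (Q x) := by
    intro Q hQ
    conv_rhs => rw [← hQ.isIdempotentElem.eq, mul_apply_eq_comp,
      ← ContinuousLinearMap.adjoint_inner_left, ← ContinuousLinearMap.star_eq_adjoint,
      hQ.isSelfAdjoint.star_eq, inner_self_eq_norm_sq_to_K]
    rfl
  have h1 : (∑ j ∈ s, ‖P j x‖ ^ 2) = ‖(∑ j ∈ s, P j) x‖ ^ 2 := by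
    have : ((∑ j ∈ s, ‖P j x‖ ^ 2 : ℝ) : ℂ) = ((‖(∑ j ∈ s, P j) x‖ ^ 2 : ℝ) : ℂ) := by
      rw [Complex.ofReal_sum]
      simp only [Complex.ofReal_pow]
      rw [key _ hQ, sum_apply, inner_sum]
      exact Finset.sum_congr rfl fun j _ => key _ (hP j)
    exact_mod_cast this
  rw [h1]
  have h2 : ‖(∑ j ∈ s, P j) x‖ ≤ ‖x‖ := by
    refine (ContinuousLinearMap.le_opNorm _ _).trans ?_
    exact mul_le_of_le_one_left (norm_nonneg _) hQ.norm_le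
  gcongr

/-- Each inner product equals `⟪P j x, P j y⟫`; the arithmetic-geometric inequality bounds it by
squared norms, to which Bessel's inequality applies. -/
theorem summable_mul_inner_of_orthogonal {K J : Type*} [NormedAddCommGroup K]
    [InnerProductSpace ℂ K] [CompleteSpace K] {P : J → K →L[ℂ] K}
    (hP : ∀ j, IsStarProjection (P j)) (hPP : Pairwise fun i j => P i * P j = 0) {c : J → ℂ}
    {C : ℝ} (hC : 0 ≤ C) (hc : ∀ j, ‖c j‖ ≤ C) (x y : K) :
    Summable (fun j => ‖c j * inner ℂ x (P j y)‖) ∧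
      ∑' j, ‖c j * inner ℂ x (P j y)‖ ≤ C * ((‖x‖ ^ 2 + ‖y‖ ^ 2) / 2) := by
  have h0 : ∀ z : K, Summable fun j => ‖P j z‖ ^ 2 := fun z =>
    summable_of_sum_le (fun _ => by positivity) (sum_norm_sq_le_of_orthogonal hP hPP z)
  have h0' : ∀ z : K, ∑' j, ‖P j z‖ ^ 2 ≤ ‖z‖ ^ 2 := fun z =>
    (h0 z).tsum_le_of_sum_le (sum_norm_sq_le_of_orthogonal hP hPP z)
  have hle : ∀ j, ‖c j * inner ℂ x (P j y)‖ ≤ C * ((‖P j x‖ ^ 2 + ‖P j y‖ ^ 2) / 2) := fun j => by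
    have : inner ℂ x (P j y) = inner ℂ (P j x) (P j y) := by
      conv_lhs => rw [← (hP j).isIdempotentElem.eq, mul_apply_eq_comp,
        ← ContinuousLinearMap.adjoint_inner_left, ← ContinuousLinearMap.star_eq_adjoint,
        (hP j).isSelfAdjoint.star_eq]
    rw [norm_mul, this]
    refine mul_le_mul (hc j) ((norm_inner_le_norm _ _).trans ?_) (norm_nonneg _) hC
    nlinarith [sq_nonneg (‖P j x‖ - ‖P j y‖)]
  have hs : Summable fun j => C * ((‖P j x‖ ^ 2 + ‖P j y‖ ^ 2) / 2) :=
    (((h0 x).add (h0 y)).div_const 2).mul_left C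
  refine ⟨hs.of_nonneg_of_le (fun _ => norm_nonneg _) hle, ?_⟩
  refine (Summable.tsum_le_tsum hle (hs.of_nonneg_of_le (fun _ => norm_nonneg _) hle) hs).trans ?_
  rw [tsum_mul_left, tsum_div_const, (h0 x).tsum_add (h0 y)]
  gcongr
  · exact h0' x
  · exact h0' y

/-- The operator `∑ c j P j` is obtained from its sesquilinear form, which is bounded by the
preceding estimate. -/
theorem exists_hasSum_inner_of_orthogonal {K J : Type*} [NormedAddCommGroup K]
    [InnerProductSpace ℂ K] [CompleteSpace K] {P : J → K →L[ℂ] K}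
    (hP : ∀ j, IsStarProjection (P j)) (hPP : Pairwise fun i j => P i * P j = 0) {c : J → ℂ}
    {C : ℝ} (hC : 0 ≤ C) (hc : ∀ j, ‖c j‖ ≤ C) :
    ∃ T : K →L[ℂ] K, ∀ x y, HasSum (fun j => c j * inner ℂ x (P j y)) (inner ℂ x (T y)) := by
  have hsum : ∀ x y, Summable fun j => c j * inner ℂ x (P j y) := fun x y =>
    (summable_mul_inner_of_orthogonal hP hPP hC hc x y).1.of_norm
  let B₀ : K →ₗ⋆[ℂ] K →ₗ[ℂ] ℂ := LinearMap.mk₂'ₛₗ (starRingEnd ℂ) (RingHom.id ℂ)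
    (fun x y => ∑' j, c j * inner ℂ x (P j y))
    (fun x x' y => by
      rw [← (hsum x y).tsum_add (hsum x' y)]
      simp only [inner_add_left, mul_add])
    (fun a x y => by
      rw [smul_eq_mul, ← tsum_mul_left]
      simp only [inner_smul_left]
      exact tsum_congr fun j => by ring)
    (fun x y y' => by
      rw [← (hsum x y).tsum_add (hsum x y')]
      simp only [map_add, inner_add_right, mul_add])
    (fun a x y => by
      rw [smul_eq_mul, ← tsum_mul_left]
      simp only [map_smul, inner_smul_right]
      exact tsum_congr fun j => by simp; ring)
  have hB : ∀ x y, ‖B₀ x y‖ ≤ C * ((‖x‖ ^ 2 + ‖y‖ ^ 2) / 2) := fun x y =>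
    (norm_tsum_le_tsum_norm (summable_mul_inner_of_orthogonal hP hPP hC hc x y).1).trans
      (summable_mul_inner_of_orthogonal hP hPP hC hc x y).2
  have hB' : ∀ x y, ‖B₀ x y‖ ≤ C * ‖x‖ * ‖y‖ := fun x y => by
    rcases eq_or_ne x 0 with rfl | hx
    · simp
    rcases eq_or_ne y 0 with rfl | hy
    · simp
    -- Applying the additive bound to unit vectors turns it into the bound `C ‖x‖ ‖y‖`.
    have h := hB ((‖x‖⁻¹ : ℂ) • x) ((‖y‖⁻¹ : ℂ) • y)
    have hx' : ‖x‖ ≠ 0 := norm_ne_zero_iff.2 hx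
    have hy' : ‖y‖ ≠ 0 := norm_ne_zero_iff.2 hy
    simp only [LinearMap.map_smulₛₗ, LinearMap.smul_apply, norm_smul, smul_eq_mul, map_inv₀,
      Complex.conj_ofReal, norm_mul, norm_inv, Complex.norm_real, norm_norm, RingHom.id_apply,
      inv_mul_cancel₀ hx', inv_mul_cancel₀ hy'] at h
    have h2 : ‖B₀ x y‖ = (‖x‖ * ‖y‖) * (‖x‖⁻¹ * (‖y‖⁻¹ * ‖B₀ x y‖)) := by field_simp
    rw [h2]
    calc (‖x‖ * ‖y‖) * (‖x‖⁻¹ * (‖y‖⁻¹ * ‖B₀ x y‖)) ≤ (‖x‖ * ‖y‖) * C := by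
          refine mul_le_mul_of_nonneg_left ?_ (by positivity)
          linarith
      _ = C * ‖x‖ * ‖y‖ := by ring
  let T := InnerProductSpace.continuousLinearMapOfBilin (B₀.mkContinuous₂ C hB')
  -- The operator attached to a form acts in the first slot of the inner product; the adjoint moves
  -- it to the second.
  refine ⟨star T, fun x y => ?_⟩
  rw [ContinuousLinearMap.star_eq_adjoint, ContinuousLinearMap.adjoint_inner_right,
    InnerProductSpace.continuousLinearMapOfBilin_apply]
  exact (hsum x y).hasSum

variable {R : Type*} [Ring R] [StarRing R] [Algebra ℂ R]
  {H : Type*} [NormedAddCommGroup H] [InnerProductSpace ℂ H] [CompleteSpace H]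
  {π : R →⋆ₐ[ℂ] (H →L[ℂ] H)}

theorem hasSum_sigmaWeak_iff {R H : Type*} [AddCommMonoid R] [NormedAddCommGroup H]
    [InnerProductSpace ℂ H] {π : R → (H →L[ℂ] H)} {J : Type*} {f : J → R} {r : R}
    (hπ : ∀ a b, π (a + b) = π a + π b) (h0 : π 0 = 0) :
    @HasSum R J _ (TopologicalSpace.induced π (sigmaWeakTopology H)) f r
        (SummationFilter.unconditional _) ↔
      ∀ ξ η : lp (fun _ : ℕ => H) 2, HasSum (fun j => inner ℂ ξ (ampL ℕ (π (f j)) η))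
        (inner ℂ ξ (ampL ℕ (π r) η)) := by
  have hs : ∀ (ξ η : lp (fun _ : ℕ => H) 2) (s : Finset J),
      inner ℂ ξ (ampL ℕ (π (∑ j ∈ s, f j)) η) = ∑ j ∈ s, inner ℂ ξ (ampL ℕ (π (f j)) η) := by
    intro ξ η s
    classical
    induction s using Finset.induction_on with
    | empty =>
      have : ampL ℕ (0 : H →L[ℂ] H) = 0 := by ext; simp
      simp [h0, this]
    | insert a s ha ih =>
      rw [Finset.sum_insert ha, Finset.sum_insert ha, hπ, ampL_add, ← ih]
      simp
  simp only [HasSum, nhds_induced, nhds_iInf, Filter.comap_iInf,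
    Filter.tendsto_iInf, Filter.tendsto_comap_iff, Prod.forall, ← hs]
  simp only [lp.inner_eq_tsum, ampL_apply, Function.comp_def]

/-- Bounded combinations of orthogonal central projections converge `σ`-weakly. -/
theorem exists_hasSum_smul_of_orthogonal (hinj : Function.Injective π)
    (hbi : Set.centralizer (Set.centralizer (Set.range π)) = Set.range π) {J : Type*} {p : J → R}
    (hp : ∀ j, IsStarProjection (p j)) (hpc : ∀ j, p j ∈ Subring.center R)
    (hpp : Pairwise fun i j => p i * p j = 0) {c : J → ℂ} {C : ℝ} (hC : 0 ≤ C)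
    (hc : ∀ j, ‖c j‖ ≤ C) :
    ∃ r ∈ Subring.center R, @HasSum R J _ (TopologicalSpace.induced π (sigmaWeakTopology H))
      (fun j => c j • p j) r (SummationFilter.unconditional _) := by
  have hP : ∀ j, IsStarProjection (π (p j)) := fun j => (hp j).map π
  have hPP : Pairwise fun i j => π (p i) * π (p j) = 0 := fun i j h => by
    change π (p i) * π (p j) = 0
    rw [← map_mul, hpp h, map_zero]
  obtain ⟨T, hT⟩ := exists_hasSum_inner_of_orthogonal hP hPP hC hc
  -- The sum `T` commutes with everything that commutes with all `π (p j)`. This covers both the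
  -- algebra, as the `p j` are central, and its commutant, so `T` comes from the center.
  have hcomm : ∀ S : H →L[ℂ] H, (∀ j, Commute S (π (p j))) → S * T = T * S := fun S hS => by
    refine ContinuousLinearMap.ext fun y => ext_inner_left ℂ fun x => ?_
    have h1 : HasSum (fun j => c j * inner ℂ x (S (π (p j) y))) (inner ℂ x (S (T y))) := by
      have h0 : ∀ v, inner ℂ x (S v) = inner ℂ (ContinuousLinearMap.adjoint S x) v := fun v =>
        (ContinuousLinearMap.adjoint_inner_left S v x).symm
      simp only [h0]
      exact hT _ _
    have h2 := hT x (S y)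
    have h3 : ∀ j, π (p j) (S y) = S (π (p j) y) := fun j =>
      DFunLike.congr_fun (hS j).eq.symm y
    simp only [h3] at h2
    exact h1.unique h2
  obtain ⟨r, hrc, hr⟩ := exists_central_eq hinj hbi (T := T)
    (by
      rintro _ ⟨a, rfl⟩
      refine hcomm _ fun j => ?_
      rw [Commute, SemiconjBy, ← map_mul, ← map_mul, Subring.mem_center_iff.1 (hpc j)])
    (fun S hS => hcomm S fun j => (hS _ ⟨_, rfl⟩).symm)
  refine ⟨r, hrc, (hasSum_sigmaWeak_iff (map_add π) (map_zero π)).2 fun ξ η => ?_⟩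
  rw [hr]
  -- The `σ`-weak functional sums over `ℕ` inside and the claim sums over `J` outside; absolute
  -- summability over `ℕ × J` permits the exchange.
  let F : ℕ × J → ℂ := fun q => c q.2 * inner ℂ (ξ q.1) (π (p q.2) (η q.1))
  have hF : Summable F := by
    refine Summable.of_norm ((summable_prod_of_nonneg fun _ => norm_nonneg _).2 ⟨fun i => ?_, ?_⟩)
    · exact (summable_mul_inner_of_orthogonal hP hPP hC hc (ξ i) (η i)).1
    · refine Summable.of_nonneg_of_le (fun i => tsum_nonneg fun _ => norm_nonneg _)
        (fun i => (summable_mul_inner_of_orthogonal hP hPP hC hc (ξ i) (η i)).2) ?_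
      exact (((memℓp_two_iff_summable.1 ξ.2).add (memℓp_two_iff_summable.1 η.2)).div_const
        2).mul_left C
  have h1 : HasSum (fun i => inner ℂ (ξ i) (T (η i))) (∑' q, F q) :=
    hF.hasSum.prod_fiberwise fun i => hT (ξ i) (η i)
  have h2 : inner ℂ ξ (ampL ℕ T η) = ∑' q, F q :=
    (lp.hasSum_inner (𝕜 := ℂ) ξ (ampL ℕ T η)).unique h1
  rw [h2]
  refine HasSum.prod_fiberwise (f := F ∘ Prod.swap)
    ((Equiv.prodComm J ℕ).hasSum_iff.2 hF.hasSum) fun j => ?_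
  have h3 := (lp.hasSum_inner (𝕜 := ℂ) ξ (ampL ℕ (π (p j)) η)).mul_left (c j)
  rw [map_smul, ampL_smul, smul_apply, inner_smul_right]
  exact h3

/-- In an atomic von Neumann algebra the minimal central projections add up to `1`. -/
theorem hasSum_minimalCentralProjection (hinj : Function.Injective π)
    (hbi : Set.centralizer (Set.centralizer (Set.range π)) = Set.range π)
    (hat : ∀ p : R, IsStarProjection p → p ≠ 0 → ∃ q : R, IsMinimalProjection q ∧ q * p = q) :
    @HasSum R {z : R // IsMinimalCentralProjection z} _
      (TopologicalSpace.induced π (sigmaWeakTopology H)) (fun z => (z : R)) 1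
      (SummationFilter.unconditional _) := by
  obtain ⟨r, hrc, hr⟩ := exists_hasSum_smul_of_orthogonal hinj hbi
    (J := {z : R // IsMinimalCentralProjection z}) (p := fun z => z) (fun z => z.2.1)
    (fun z => z.2.2.1) (fun z w h => z.2.mul_eq_zero w.2 fun e => h (Subtype.ext e))
    (c := fun _ => 1) zero_le_one fun _ => by simp
  simp only [one_smul] at hr
  have key : ∀ z : R, IsMinimalCentralProjection z → z * r = z := fun z hz => by
    let t := TopologicalSpace.induced π (sigmaWeakTopology H)
    have : @T2Space R t := by
      have := t2Space_sigmaWeak (H := H)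
      let s := sigmaWeakTopology H
      exact T2Space.of_injective_continuous hinj continuous_induced_dom
    have h1 : HasSum (fun w : {z : R // IsMinimalCentralProjection z} => z * w) (z * r) := by
      refine hr.map (AddMonoidHom.mulLeft z) ?_
      refine continuous_induced_rng.2 ?_
      have : (π ∘ (AddMonoidHom.mulLeft z)) = (fun x => π z * x) ∘ π := by ext; simp
      rw [this]
      let s := sigmaWeakTopology H
      exact (continuous_sigmaWeak_mul_left (π z)).comp continuous_induced_dom
    refine h1.unique ?_
    convert hasSum_single (⟨z, hz⟩ : {z : R // IsMinimalCentralProjection z}) fun w hw => ?_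
    · exact hz.1.isIdempotentElem.eq.symm
    · exact hz.mul_eq_zero w.2 fun e => hw (Subtype.ext e.symm)
  -- Passing to the support `p` of `1 - r` avoids showing that `r` is a projection. A minimal
  -- central projection below a nonzero `p` would annihilate `1 - r` by `key`, hence `p`, and so
  -- itself.
  obtain ⟨p, hpc, hp, hpy, hpx, -⟩ := exists_central_support hinj hbi (1 - r)
  rcases eq_or_ne p 0 with rfl | hp0
  · rw [zero_mul, eq_comm, sub_eq_zero] at hpy
    rwa [hpy]
  · obtain ⟨z, hz, hzp⟩ := exists_isMinimalCentralProjection hinj hbi hat hp hpc hp0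
    have := hpx z hz.2.1 (by rw [mul_sub, mul_one, key z hz, sub_self])
    exact absurd (hzp.symm.trans this) hz.2.2.1

end OrthogonalSum

/-! ### Families of normal states -/

section States

theorem exists_lp_uncurry {J : Type*} {ι : J → Type*} {H : Type*} [NormedAddCommGroup H]
    [InnerProductSpace ℂ H] (ξ : ∀ j, lp (fun _ : ι j => H) 2)
    (hξ : Summable fun j => ‖ξ j‖ ^ 2) :
    ∃ ζ : lp (fun _ : Σ j, ι j => H) 2, ∀ j i, ζ ⟨j, i⟩ = ξ j i := by
  refine ⟨⟨fun q => ξ q.1 q.2, ?_⟩, fun _ _ => rfl⟩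
  change Memℓp _ 2
  rw [memℓp_two_iff_summable, summable_sigma_of_nonneg fun _ => by positivity]
  refine ⟨fun j => memℓp_two_iff_summable.1 (ξ j).2, hξ.congr fun j => ?_⟩
  have h := lp.norm_rpow_eq_tsum (p := 2) (by norm_num) (ξ j)
  simpa using h

theorem hasSum_inner_ampL_uncurry {J : Type*} {ι : J → Type*} {H : Type*} [NormedAddCommGroup H]
    [InnerProductSpace ℂ H] {ξ η : ∀ j, lp (fun _ : ι j => H) 2}
    {ξ' η' : lp (fun _ : Σ j, ι j => H) 2} (hξ : ∀ j i, ξ' ⟨j, i⟩ = ξ j i)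
    (hη : ∀ j i, η' ⟨j, i⟩ = η j i) (x : H →L[ℂ] H) :
    HasSum (fun j => inner ℂ (ξ j) (ampL (ι j) x (η j))) (inner ℂ ξ' (ampL (Σ j, ι j) x η')) := by
  refine (lp.hasSum_inner (𝕜 := ℂ) ξ' (ampL (Σ j, ι j) x η')).sigma fun j => ?_
  simp only [ampL_apply, hξ, hη]
  exact lp.hasSum_inner (𝕜 := ℂ) (ξ j) (ampL (ι j) x (η j))

variable {R : Type*} [Ring R] [StarRing R] [Algebra ℂ R] [StarModule ℂ R]
  {H : Type*} [NormedAddCommGroup H] [InnerProductSpace ℂ H] [CompleteSpace H]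
  {π : R →⋆ₐ[ℂ] (H →L[ℂ] H)}

theorem norm_apply_le_of_continuous_of_nonneg {τ : R →ₗ[ℂ] ℂ}
    (hτ : Continuous[TopologicalSpace.induced π (sigmaWeakTopology H), inferInstance] τ)
    (hpos : ∀ a, 0 ≤ τ (star a * a)) (a : R) : ‖τ a‖ ≤ ‖π a‖ * (τ 1).re := by
  obtain ⟨ι, ζ, h⟩ := exists_vector_of_continuous_of_nonneg hτ hpos
  have h1 : (τ 1).re = ‖ζ‖ ^ 2 := by
    rw [h, map_one, ampL_one, one_apply_eq_self, inner_self_eq_norm_sq_to_K]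
    norm_cast
  rw [h, h1]
  refine (norm_inner_le_norm _ _).trans ?_
  have h2 := ((ampL ι (π a)).le_opNorm ζ).trans
    (mul_le_mul_of_nonneg_right (norm_ampL_le (π a)) (norm_nonneg ζ))
  nlinarith [norm_nonneg ζ]

/-- Each `τ j` is given by a vector `ζ j` of norm at most `1`. Writing `c j = conj (s j) * d j` with
`‖s j‖²` and `‖d j‖²` at most `‖c j‖`, the families `s j • ζ j` and `d j • ζ j` are square-summable
and combine into two vectors representing the whole series. -/
theorem continuous_tsum_mul {J : Type*} {τ : J → R →ₗ[ℂ] ℂ}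
    (hτ : ∀ j, Continuous[TopologicalSpace.induced π (sigmaWeakTopology H), inferInstance] (τ j))
    (hpos : ∀ j a, 0 ≤ τ j (star a * a)) (hone : ∀ j, (τ j 1).re ≤ 1) {c : J → ℂ}
    (hc : Summable fun j => ‖c j‖) :
    Continuous[TopologicalSpace.induced π (sigmaWeakTopology H), inferInstance]
      fun a => ∑' j, c j * τ j a := by
  choose ι ζ h using fun j => exists_vector_of_continuous_of_nonneg (hτ j) (hpos j)
  have h1 : ∀ j, ‖ζ j‖ ^ 2 ≤ 1 := fun j => by
    convert hone j
    rw [h, map_one, ampL_one, one_apply_eq_self, inner_self_eq_norm_sq_to_K]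
    norm_cast
  let s : J → ℂ := fun j => (Real.sqrt ‖c j‖ : ℂ)
  have hs : ∀ j, ‖s j‖ ^ 2 = ‖c j‖ := fun j => by
    simp [s, Real.sq_sqrt]
  have hd : ∀ j, ∃ d : ℂ, c j = (starRingEnd ℂ (s j)) * d ∧ ‖d‖ ^ 2 ≤ ‖c j‖ := fun j => by
    rcases eq_or_ne (c j) 0 with h0 | h0
    · exact ⟨0, by simp [h0], by simp⟩
    · have hs0 : s j ≠ 0 := by
        intro h0'
        have := hs j
        rw [h0'] at this
        simp at this
        exact h0 (norm_eq_zero.1 this.symm)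
      refine ⟨c j / starRingEnd ℂ (s j), ?_, ?_⟩
      · rw [mul_div_cancel₀]
        simpa using hs0
      · rw [norm_div, RCLike.norm_conj, div_pow, hs]
        have : ‖c j‖ ≠ 0 := by simpa using h0
        apply le_of_eq
        field_simp
  choose d hcd hdn using hd
  have hsum : ∀ e : J → ℂ, (∀ j, ‖e j‖ ^ 2 ≤ ‖c j‖) → Summable fun j => ‖e j • ζ j‖ ^ 2 :=
    fun e he => hc.of_nonneg_of_le (fun _ => by positivity) fun j => by
      rw [norm_smul, mul_pow]
      calc ‖e j‖ ^ 2 * ‖ζ j‖ ^ 2 ≤ ‖c j‖ * 1 :=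
            mul_le_mul (he j) (h1 j) (by positivity) (norm_nonneg _)
        _ = ‖c j‖ := mul_one _
  obtain ⟨ξ, hξ⟩ := exists_lp_uncurry (fun j => s j • ζ j) (hsum s fun j => (hs j).le)
  obtain ⟨η, hη⟩ := exists_lp_uncurry (fun j => d j • ζ j) (hsum d hdn)
  have key : ∀ a, ∑' j, c j * τ j a = inner ℂ ξ (ampL _ (π a) η) := fun a => by
    refine HasSum.tsum_eq ?_
    convert hasSum_inner_ampL_uncurry hξ hη (π a) using 2 with j
    rw [map_smul, inner_smul_left, inner_smul_right, h, hcd j, mul_assoc]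
  simp only [key]
  let t := sigmaWeakTopology H
  let t' := TopologicalSpace.induced π (sigmaWeakTopology H)
  exact (continuous_sigmaWeak_inner ξ η).comp continuous_induced_dom

end States

/-! ### Tensor products of operators -/

section Tensor

variable {H K : Type*} [NormedAddCommGroup H] [InnerProductSpace ℂ H]
    [NormedAddCommGroup K] [InnerProductSpace ℂ K]

/-- Elementary tensors in the Hilbert space tensor product. -/
def hTmul (h : H) (k : K) : HilbertTensor H K := ((h ⊗ₜ[ℂ] k : H ⊗[ℂ] K) : HilbertTensor H K)

theorem opTensor_hTmul (S : H →L[ℂ] H) (T : K →L[ℂ] K) (h : H) (k : K) :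
    opTensor S T (hTmul h k) = hTmul (S h) (T k) := by
  rw [opTensor, hTmul, ContinuousLinearMap.completion_apply_coe, TensorProduct.mapL_tmul, hTmul]

theorem inner_hTmul (h h' : H) (k k' : K) :
    inner ℂ (hTmul h k) (hTmul h' k') = inner ℂ h h' * inner ℂ k k' := by
  rw [hTmul, hTmul, UniformSpace.Completion.inner_coe, TensorProduct.inner_tmul]

theorem hTmul_add_left (h h' : H) (k : K) : hTmul (h + h') k = hTmul h k + hTmul h' k := by
  simp only [hTmul, TensorProduct.add_tmul, UniformSpace.Completion.coe_add]

theorem hTmul_add_right (h : H) (k k' : K) : hTmul h (k + k') = hTmul h k + hTmul h k' := by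
  simp only [hTmul, TensorProduct.tmul_add, UniformSpace.Completion.coe_add]

theorem hTmul_smul_left (c : ℂ) (h : H) (k : K) : hTmul (c • h) k = c • hTmul h k := by
  simp only [hTmul, ← TensorProduct.smul_tmul', UniformSpace.Completion.coe_smul]

theorem hTmul_smul_right (c : ℂ) (h : H) (k : K) : hTmul h (c • k) = c • hTmul h k := by
  simp only [hTmul, TensorProduct.tmul_smul, UniformSpace.Completion.coe_smul]

theorem continuous_hTmul : Continuous fun p : H × K => hTmul p.1 p.2 :=
  (UniformSpace.Completion.continuous_coe _).comp TensorProduct.continuous_tmul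

theorem hilbertTensor_eq_top_of_hTmul_mem {W : Submodule ℂ (HilbertTensor H K)}
    (hW : IsClosed (W : Set (HilbertTensor H K))) (h : ∀ x y, hTmul x y ∈ W) : W = ⊤ := by
  refine eq_top_iff.2 fun x _ => ?_
  refine UniformSpace.Completion.induction_on x hW fun t => ?_
  induction t using TensorProduct.induction_on with
  | zero => rw [UniformSpace.Completion.coe_zero]; exact W.zero_mem
  | tmul x y => exact h x y
  | add x y hx hy => rw [UniformSpace.Completion.coe_add]; exact W.add_mem hx hy

theorem hilbertTensor_op_ext {E : Type*} [NormedAddCommGroup E] [NormedSpace ℂ E]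
    {S T : HilbertTensor H K →L[ℂ] E} (h : ∀ x y, S (hTmul x y) = T (hTmul x y)) : S = T := by
  have : LinearMap.eqLocus S.toLinearMap T.toLinearMap = ⊤ :=
    hilbertTensor_eq_top_of_hTmul_mem (isClosed_eq S.continuous T.continuous) h
  ext x
  exact (this ▸ Submodule.mem_top : x ∈ LinearMap.eqLocus S.toLinearMap T.toLinearMap)

theorem opTensor_mul (S S' : H →L[ℂ] H) (T T' : K →L[ℂ] K) :
    opTensor (S * S') (T * T') = opTensor S T * opTensor S' T' :=
  hilbertTensor_op_ext fun x y => by simp only [mul_apply_eq_comp, opTensor_hTmul]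

theorem opTensor_add_left (S S' : H →L[ℂ] H) (T : K →L[ℂ] K) :
    opTensor (S + S') T = opTensor S T + opTensor S' T :=
  hilbertTensor_op_ext fun x y => by
    simp only [add_apply, opTensor_hTmul, hTmul_add_left]

theorem opTensor_add_right (S : H →L[ℂ] H) (T T' : K →L[ℂ] K) :
    opTensor S (T + T') = opTensor S T + opTensor S T' :=
  hilbertTensor_op_ext fun x y => by
    simp only [add_apply, opTensor_hTmul, hTmul_add_right]

theorem opTensor_smul_left (c : ℂ) (S : H →L[ℂ] H) (T : K →L[ℂ] K) :
    opTensor (c • S) T = c • opTensor S T :=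
  hilbertTensor_op_ext fun x y => by
    simp only [smul_apply, opTensor_hTmul, hTmul_smul_left]

theorem opTensor_smul_right (c : ℂ) (S : H →L[ℂ] H) (T : K →L[ℂ] K) :
    opTensor S (c • T) = c • opTensor S T :=
  hilbertTensor_op_ext fun x y => by
    simp only [smul_apply, opTensor_hTmul, hTmul_smul_right]

theorem opTensor_star [CompleteSpace H] [CompleteSpace K] (S : H →L[ℂ] H) (T : K →L[ℂ] K) :
    opTensor (star S) (star T) = star (opTensor S T) := by
  refine hilbertTensor_op_ext fun x y => ext_inner_right ℂ fun w => ?_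
  have : innerSL ℂ (opTensor (star S) (star T) (hTmul x y)) =
      innerSL ℂ (star (opTensor S T) (hTmul x y)) := hilbertTensor_op_ext fun u v => by
    simp only [innerSL_apply_apply, opTensor_hTmul, ContinuousLinearMap.star_eq_adjoint,
      ContinuousLinearMap.adjoint_inner_left, inner_hTmul]
  exact DFunLike.congr_fun this w

/-- An operation on operators that amplifies along a Hilbert sum is `σ`-weakly continuous. -/
theorem continuous_sigmaWeak_of_isHilbertSum {E J : Type*} [NormedAddCommGroup E]
    [InnerProductSpace ℂ E] [CompleteSpace E] [CompleteSpace H] {V : J → H →ₗᵢ[ℂ] E}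
    (hV : IsHilbertSum ℂ (fun _ : J => H) V) {Φ : (H →L[ℂ] H) → E →L[ℂ] E}
    (hΦ : ∀ S j h, Φ S (V j h) = V j (S h)) :
    Continuous[sigmaWeakTopology H, sigmaWeakTopology E] Φ := by
  -- Identifying `E` with `ℓ²(J, H)` turns `Φ S` into the amplification of `S`, so a functional
  -- given by sequences in `E` becomes one given by families in `H` indexed by pairs in `ℕ` and `J`.
  let L := hV.linearIsometryEquiv
  have hL : ∀ S x, L (Φ S x) = ampL J S (L x) := fun S x => by
    rw [← L.symm.injective.eq_iff, L.symm_apply_apply]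
    have h1 := hV.hasSum_linearIsometryEquiv_symm (L x)
    have h2 := hV.hasSum_linearIsometryEquiv_symm (ampL J S (L x))
    have h3 := h1.mapL (Φ S)
    simp only [hΦ] at h3
    have h4 := h3.unique h2
    rwa [show hV.linearIsometryEquiv.symm (L x) = x from L.symm_apply_apply x] at h4
  have hn : ∀ ξ : lp (fun _ : ℕ => E) 2, Summable fun i => ‖L (ξ i)‖ ^ 2 := fun ξ => by
    simpa using memℓp_two_iff_summable.1 ξ.2
  refine continuous_sigmaWeak_rng_iff.2 fun ξ η => ?_
  obtain ⟨ξ', hξ'⟩ := exists_lp_uncurry _ (hn ξ)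
  obtain ⟨η', hη'⟩ := exists_lp_uncurry _ (hn η)
  convert continuous_sigmaWeak_inner ξ' η' using 2 with S
  refine HasSum.unique (lp.hasSum_inner (𝕜 := ℂ) ξ (ampL ℕ (Φ S) η)) ?_
  have h := hasSum_inner_ampL_uncurry hξ' hη' S
  simp only [← hL, L.inner_map_map] at h
  exact h

variable [CompleteSpace H] [CompleteSpace K]

/-- A Hilbert basis of `K` splits the tensor product into copies of `H` on which `S ⊗ 1` is the
amplification of `S`. The general case follows from `S ⊗ T = (S ⊗ 1)(1 ⊗ T)`. -/
theorem continuous_opTensor_left (T : K →L[ℂ] K) :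
    Continuous[sigmaWeakTopology H, sigmaWeakTopology (HilbertTensor H K)]
      fun S => opTensor S T := by
  obtain ⟨w, b, -⟩ := exists_hilbertBasis ℂ K
  let V : w → H →ₗᵢ[ℂ] HilbertTensor H K := fun j =>
    LinearMap.isometryOfInner
      { toFun := fun h => hTmul h (b j)
        map_add' := fun x y => hTmul_add_left x y _
        map_smul' := fun c x => hTmul_smul_left c x _ }
      fun x y => by
        change inner ℂ (hTmul x (b j)) (hTmul y (b j)) = _
        rw [inner_hTmul, inner_self_eq_norm_sq_to_K, b.orthonormal.1 j]
        simp
  have hV : IsHilbertSum ℂ (fun _ : w => H) V := by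
    refine IsHilbertSum.mk (fun i j hij x y => ?_) (top_le_iff.2 ?_)
    · change inner ℂ (hTmul x (b i)) (hTmul y (b j)) = 0
      rw [inner_hTmul, b.orthonormal.2 hij, mul_zero]
    · refine hilbertTensor_eq_top_of_hTmul_mem (Submodule.isClosed_topologicalClosure _)
        fun x y => ?_
      let f : K →ₗ[ℂ] HilbertTensor H K :=
        { toFun := fun k => hTmul x k
          map_add' := fun u v => hTmul_add_right x u v
          map_smul' := fun c u => hTmul_smul_right c x u }
      have hf : Continuous f := continuous_hTmul.comp (by fun_prop : Continuous fun k : K => (x, k))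
      have hy : y ∈ closure (Submodule.span ℂ (Set.range b) : Set K) := by
        have : y ∈ (Submodule.span ℂ (Set.range b)).topologicalClosure :=
          b.dense_span ▸ Submodule.mem_top
        exact this
      refine map_mem_closure hf hy fun u hu => ?_
      have : Submodule.span ℂ (Set.range b) ≤
          (⨆ i, LinearMap.range (V i).toLinearMap).comap f := by
        rw [Submodule.span_le]
        rintro _ ⟨j, rfl⟩
        exact Submodule.mem_iSup_of_mem j ⟨x, rfl⟩
      exact this hu
  have h1 : Continuous[sigmaWeakTopology H, sigmaWeakTopology (HilbertTensor H K)]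
      fun S => opTensor S (1 : K →L[ℂ] K) :=
    continuous_sigmaWeak_of_isHilbertSum hV fun S j h => opTensor_hTmul S 1 h (b j)
  have h2 : (fun S : H →L[ℂ] H => opTensor S T) =
      (fun x => x * opTensor 1 T) ∘ fun S => opTensor S (1 : K →L[ℂ] K) := by
    ext1 S
    rw [Function.comp_apply, ← opTensor_mul, mul_one, one_mul]
  rw [h2]
  let t := sigmaWeakTopology H
  let t' := sigmaWeakTopology (HilbertTensor H K)
  exact (continuous_sigmaWeak_mul_right _).comp h1

theorem continuous_opTensor_right (S : H →L[ℂ] H) :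
    Continuous[sigmaWeakTopology K, sigmaWeakTopology (HilbertTensor H K)]
      fun T => opTensor S T := by
  obtain ⟨w, b, -⟩ := exists_hilbertBasis ℂ H
  let V : w → K →ₗᵢ[ℂ] HilbertTensor H K := fun j =>
    LinearMap.isometryOfInner
      { toFun := fun k => hTmul (b j) k
        map_add' := fun x y => hTmul_add_right _ x y
        map_smul' := fun c x => hTmul_smul_right c _ x }
      fun x y => by
        change inner ℂ (hTmul (b j) x) (hTmul (b j) y) = _
        rw [inner_hTmul, inner_self_eq_norm_sq_to_K, b.orthonormal.1 j]
        simp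
  have hV : IsHilbertSum ℂ (fun _ : w => K) V := by
    refine IsHilbertSum.mk (fun i j hij x y => ?_) (top_le_iff.2 ?_)
    · change inner ℂ (hTmul (b i) x) (hTmul (b j) y) = 0
      rw [inner_hTmul, b.orthonormal.2 hij, zero_mul]
    · refine hilbertTensor_eq_top_of_hTmul_mem (Submodule.isClosed_topologicalClosure _)
        fun x y => ?_
      let f : H →ₗ[ℂ] HilbertTensor H K :=
        { toFun := fun h => hTmul h y
          map_add' := fun u v => hTmul_add_left u v y
          map_smul' := fun c u => hTmul_smul_left c u y }
      have hf : Continuous f := continuous_hTmul.comp (by fun_prop : Continuous fun h : H => (h, y))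
      have hx : x ∈ closure (Submodule.span ℂ (Set.range b) : Set H) := by
        have : x ∈ (Submodule.span ℂ (Set.range b)).topologicalClosure :=
          b.dense_span ▸ Submodule.mem_top
        exact this
      change f x ∈ closure _
      refine map_mem_closure hf hx fun u hu => ?_
      have : Submodule.span ℂ (Set.range b) ≤
          (⨆ i, LinearMap.range (V i).toLinearMap).comap f := by
        rw [Submodule.span_le]
        rintro _ ⟨j, rfl⟩
        exact Submodule.mem_iSup_of_mem j ⟨y, rfl⟩
      exact this hu
  have h1 : Continuous[sigmaWeakTopology K, sigmaWeakTopology (HilbertTensor H K)]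
      fun T => opTensor (1 : H →L[ℂ] H) T :=
    continuous_sigmaWeak_of_isHilbertSum hV fun T j k => opTensor_hTmul 1 T (b j) k
  have h2 : (fun T : K →L[ℂ] K => opTensor S T) =
      (fun x => opTensor S 1 * x) ∘ fun T => opTensor (1 : H →L[ℂ] H) T := by
    ext1 T
    rw [Function.comp_apply, ← opTensor_mul, mul_one, one_mul]
  rw [h2]
  let t := sigmaWeakTopology K
  let t' := sigmaWeakTopology (HilbertTensor H K)
  exact (continuous_sigmaWeak_mul_left _).comp h1

end Tensor

/-! ### Normal KMS functionals -/

/-- Polarization of the pair `(1, g)`: the squares of `1 + c g`, for the fourth roots of unity `c`,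
are added with weights `conj c / 4`. Only `h` has to lie in `S`, so `S` need not be closed under
`star`. -/
theorem mem_span_star_mul_self {R : Type*} [Ring R] [StarRing R] [Algebra ℂ R] [StarModule ℂ R]
    (S : Subalgebra ℂ R) {g : R} (hg : g ∈ S) :
    g ∈ Submodule.span ℂ {x | ∃ h ∈ S, x = star h * h} := by
  have hmem : ∀ c : ℂ, star (1 + c • g) * (1 + c • g) ∈
      Submodule.span ℂ {x | ∃ h ∈ S, x = star h * h} := fun c =>
    Submodule.subset_span ⟨_, S.add_mem S.one_mem (S.smul_mem hg c), rfl⟩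
  have key : g = (1 / 4 : ℂ) • (star (1 + (1 : ℂ) • g) * (1 + (1 : ℂ) • g)) +
      (-Complex.I / 4) • (star (1 + Complex.I • g) * (1 + Complex.I • g)) +
      (-1 / 4 : ℂ) • (star (1 + (-1 : ℂ) • g) * (1 + (-1 : ℂ) • g)) +
      (Complex.I / 4) • (star (1 + (-Complex.I) • g) * (1 + (-Complex.I) • g)) := by
    simp only [star_add, star_one, star_smul, RCLike.star_def, map_one, map_neg, Complex.conj_I,
      add_mul, mul_add, one_mul, mul_one, smul_mul_assoc, mul_smul_comm, smul_smul, smul_add]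
    match_scalars <;> ring_nf <;> simp [Complex.I_sq] <;> ring_nf
  rw [key]
  refine Submodule.add_mem _ (Submodule.add_mem _ (Submodule.add_mem _ ?_ ?_) ?_) ?_ <;>
    exact Submodule.smul_mem _ _ (hmem _)

namespace AtomicFlowSequence

variable {A : Type*} [CStarAlgebra A] {H : ℕ → Type*}
  [∀ n, NormedAddCommGroup (H n)] [∀ n, InnerProductSpace ℂ (H n)] [∀ n, CompleteSpace (H n)]
  (D : AtomicFlowSequence A H)

/-! #### The flow -/

theorem flow_zero (a : A) : D.flow 0 a = a :=
  (D.flow 0).injective (((D.flow_add 0 0 a).symm).trans (by rw [add_zero]; rfl))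

theorem flowOn_mul (n : ℕ) (t : ℝ) (a b : D.alg n) :
    D.flowOn n t (a * b) = D.flowOn n t a * D.flowOn n t b :=
  Subtype.ext (map_mul (D.flow t) (a : A) b)

theorem flowOn_one (n : ℕ) (t : ℝ) : D.flowOn n t 1 = 1 :=
  Subtype.ext (map_one (D.flow t))

theorem flowOn_zero (n : ℕ) (t : ℝ) : D.flowOn n t 0 = 0 :=
  Subtype.ext (map_zero (D.flow t))

theorem flowOn_star (n : ℕ) (t : ℝ) (a : D.alg n) :
    D.flowOn n t (star a) = star (D.flowOn n t a) :=
  Subtype.ext (map_star (D.flow t) (a : A))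

theorem flowOn_zero_time (n : ℕ) (a : D.alg n) : D.flowOn n 0 a = a :=
  Subtype.ext (D.flow_zero a)

theorem flowOn_flowOn_neg (n : ℕ) (t : ℝ) (a : D.alg n) :
    D.flowOn n t (D.flowOn n (-t) a) = a :=
  Subtype.ext (by
    change D.flow t (D.flow (-t) a) = a
    rw [← D.flow_add, add_neg_cancel, D.flow_zero])

theorem flowOn_neg_flowOn (n : ℕ) (t : ℝ) (a : D.alg n) :
    D.flowOn n (-t) (D.flowOn n t a) = a := by
  simpa using D.flowOn_flowOn_neg n (-t) a

theorem isStarProjection_flowOn {n : ℕ} {p : D.alg n} (hp : IsStarProjection p) (t : ℝ) :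
    IsStarProjection (D.flowOn n t p) :=
  ⟨by rw [IsIdempotentElem, ← flowOn_mul, hp.isIdempotentElem.eq],
    by rw [IsSelfAdjoint, ← flowOn_star, hp.isSelfAdjoint.star_eq]⟩

theorem flowOn_mem_center {n : ℕ} {p : D.alg n} (hp : p ∈ Subring.center (D.alg n)) (t : ℝ) :
    D.flowOn n t p ∈ Subring.center (D.alg n) :=
  Subring.mem_center_iff.2 fun a => by
    rw [← D.flowOn_flowOn_neg n t a, ← flowOn_mul, ← flowOn_mul, Subring.mem_center_iff.1 hp]

theorem isMinimalCentralProjection_flowOn {n : ℕ} {p : D.alg n}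
    (hp : IsMinimalCentralProjection p) (t : ℝ) :
    IsMinimalCentralProjection (D.flowOn n t p) := by
  refine ⟨D.isStarProjection_flowOn hp.1 t, D.flowOn_mem_center hp.2.1 t, fun h => hp.2.2.1 ?_,
    fun r hr hrc hrp => ?_⟩
  · rw [← D.flowOn_neg_flowOn n t p, h, flowOn_zero]
  · rcases hp.2.2.2 _ (D.isStarProjection_flowOn hr (-t)) (D.flowOn_mem_center hrc (-t))
      (by rw [← D.flowOn_neg_flowOn n t p, ← flowOn_mul, hrp]) with h | h
    · exact Or.inl (by rw [← D.flowOn_flowOn_neg n t r, h, flowOn_zero])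
    · exact Or.inr (by rw [← D.flowOn_flowOn_neg n t r, h])

/-! #### KMS functionals -/

variable {D} {β : ℝ}

/-- The `β`-KMS condition for a functional on `Aₙ`. -/
def IsKMSFunctional (D : AtomicFlowSequence A H) (β : ℝ) (n : ℕ) (φ : D.alg n →ₗ[ℂ] ℂ) : Prop :=
  ∀ a b : D.alg n, ∃ F : ℂ → ℂ,
    ContinuousOn F {w | w.im ∈ Set.uIcc 0 β} ∧
    (∃ C : ℝ, ∀ w : ℂ, w.im ∈ Set.uIcc 0 β → ‖F w‖ ≤ C) ∧
    DifferentiableOn ℂ F {w | w.im ∈ Set.uIoo 0 β} ∧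
    (∀ t : ℝ, F t = φ (b * D.flowOn n t a)) ∧
    ∀ t : ℝ, F (t + β * Complex.I) = φ (D.flowOn n t a * b)

/-- Positive normal functionals satisfying the KMS condition. -/
structure IsNormalKMSFunctional (D : AtomicFlowSequence A H) (β : ℝ) (n : ℕ)
    (φ : D.alg n →ₗ[ℂ] ℂ) : Prop where
  nonneg : ∀ a, 0 ≤ φ (star a * a)
  normal : Continuous[D.sigmaWeak n, inferInstance] φ
  kms : D.IsKMSFunctional β n φ

theorem coe_comm {n : ℕ} (z : D.Z n) (a : D.alg n) : a * (z : D.alg n) = z * a :=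
  Subalgebra.mem_center_iff.1 z.2 a

theorem minZ_mul_self {n : ℕ} {z : D.Z n} (hz : z ∈ D.minZ n) :
    (z : D.alg n) * z = z := hz.1.isIdempotentElem.eq

theorem minZ_star {n : ℕ} {z : D.Z n} (hz : z ∈ D.minZ n) :
    star (z : D.alg n) = z := hz.1.isSelfAdjoint.star_eq

theorem tau_spec (hβ : D.HasUniqueKMSStates β) {n : ℕ} {z : D.Z n} (hz : z ∈ D.minZ n) :
    D.IsNormalKMSState β n z (D.tau β n z) :=
  Classical.epsilon_spec (hβ n z hz).exists

theorem eq_tau (hβ : D.HasUniqueKMSStates β) {n : ℕ} {z : D.Z n} (hz : z ∈ D.minZ n)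
    {τ : D.alg n →ₗ[ℂ] ℂ} (h : D.IsNormalKMSState β n z τ) : τ = D.tau β n z :=
  (hβ n z hz).unique h (tau_spec hβ hz)

theorem tau_one (hβ : D.HasUniqueKMSStates β) {n : ℕ} {z : D.Z n} (hz : z ∈ D.minZ n) :
    D.tau β n z 1 = 1 := by
  rw [← (tau_spec hβ hz).supported, mul_one, (tau_spec hβ hz).map_unit]

/-- The flow permutes minimal central projections, and distinct ones are orthogonal, so `t ↦
τ_z(αᵗ(z))` takes only the values `0` and `1`. It is continuous and equals `1` at time `0`, hence it
is constantly `1`. -/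
theorem flowOn_minZ (hβ : D.HasUniqueKMSStates β) {n : ℕ} {z : D.Z n} (hz : z ∈ D.minZ n)
    (t : ℝ) : D.flowOn n t z = z := by
  have hτ := tau_spec hβ hz
  set τ := D.tau β n z
  have hval : ∀ s, D.flowOn n s z = z ∨ τ (D.flowOn n s z) = 0 := fun s => by
    by_cases h : D.flowOn n s z = z
    · exact Or.inl h
    · refine Or.inr ?_
      rw [← hτ.supported, IsMinimalCentralProjection.mul_eq_zero hz
        (D.isMinimalCentralProjection_flowOn hz s) (Ne.symm h), map_zero]
  have hval' : ∀ s, τ (D.flowOn n s z) = 1 ∨ τ (D.flowOn n s z) = 0 := fun s =>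
    (hval s).imp_left fun h => by rw [h, hτ.map_unit]
  have hloc : IsLocallyConstant fun s => τ (D.flowOn n s z) := by
    rw [IsLocallyConstant.iff_eventually_eq]
    intro t₀
    -- This choice of `ε` makes the variation of `τ (αˢ(z))` near `t₀` smaller than `1`, the gap
    -- between the two possible values.
    have hpos : 0 < 1 / (2 * (‖((z : D.alg n) : A)‖ + 1)) := by positivity
    filter_upwards [D.flow_u_continuous n τ hτ.normal t₀ _ hpos] with s hs
    have h1 : ‖τ (D.flowOn n s z) - τ (D.flowOn n t₀ z)‖ < 1 := by
      refine (hs z).trans_lt ?_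
      rw [div_mul_eq_mul_div, one_mul, div_lt_one (by positivity)]
      linarith [norm_nonneg ((z : D.alg n) : A)]
    rcases hval' s with h | h <;> rcases hval' t₀ with h' | h' <;> rw [h, h'] at h1 ⊢ <;>
      norm_num at h1
  have h1 : τ (D.flowOn n t z) = 1 := by
    have := hloc.apply_eq_of_preconnectedSpace t 0
    rw [this, D.flowOn_zero_time, hτ.map_unit]
  exact (hval t).resolve_right (by rw [h1]; exact one_ne_zero)

/-- The condition for `a, b` in `Aₙ` is the one for `z a, z b`: the flow fixes `z`, and `τ_z` does
not see multiplication by `z`. -/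
theorem isNormalKMSFunctional_tau (hβ : D.HasUniqueKMSStates β) {n : ℕ} {z : D.Z n}
    (hz : z ∈ D.minZ n) : D.IsNormalKMSFunctional β n (D.tau β n z) := by
  have hτ := tau_spec hβ hz
  refine ⟨hτ.nonneg, hτ.normal, fun a b => ?_⟩
  have hzz : ∀ x : D.alg n, (z : D.alg n) * (z * x) = z * x := fun x => by
    rw [← mul_assoc, minZ_mul_self hz]
  obtain ⟨F, h1, h2, h3, h4, h5⟩ := hτ.kms (z * a) (z * b) (hzz a) (hzz b)
  refine ⟨F, h1, h2, h3, fun t => ?_, fun t => ?_⟩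
  · rw [h4, D.flowOn_mul, flowOn_minZ hβ hz, mul_assoc, hτ.supported, ← mul_assoc, coe_comm,
      mul_assoc, hτ.supported]
  · rw [h5, D.flowOn_mul, flowOn_minZ hβ hz, mul_assoc, hτ.supported, ← mul_assoc, coe_comm,
      mul_assoc, hτ.supported]

theorem continuous_sigmaWeak_mul_left_alg (n : ℕ) (y : D.alg n) :
    Continuous[D.sigmaWeak n, D.sigmaWeak n] fun x => y * x := by
  refine continuous_induced_rng.2 ?_
  have : (D.rep n ∘ fun x => y * x) = (fun x => D.rep n y * x) ∘ D.rep n := by ext1 x; simp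
  rw [this]
  let s := sigmaWeakTopology (H n)
  let t := D.sigmaWeak n
  exact (continuous_sigmaWeak_mul_left (D.rep n y)).comp continuous_induced_dom

theorem continuous_comp_mulLeft {n : ℕ} {φ : D.alg n →ₗ[ℂ] ℂ}
    (hφ : Continuous[D.sigmaWeak n, inferInstance] φ) (y : D.alg n) :
    Continuous[D.sigmaWeak n, inferInstance] (φ ∘ₗ LinearMap.mulLeft ℂ y) := by
  let t := D.sigmaWeak n
  exact hφ.comp (continuous_sigmaWeak_mul_left_alg n y)

/-- On the summand `z Aₙ` every positive normal KMS functional is a multiple of `τ_z`. -/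
theorem IsNormalKMSFunctional.apply_mul (hβ : D.HasUniqueKMSStates β) {n : ℕ}
    {φ : D.alg n →ₗ[ℂ] ℂ} (hφ : D.IsNormalKMSFunctional β n φ) {z : D.Z n} (hz : z ∈ D.minZ n)
    (a : D.alg n) : φ (z * a) = φ z * D.tau β n z a := by
  have hsq : ∀ x : D.alg n, (z : D.alg n) * (star x * x) = star (z * x) * (z * x) := fun x => by
    rw [star_mul, minZ_star hz, mul_assoc, ← mul_assoc (z : D.alg n) z, minZ_mul_self hz,
      ← mul_assoc, ← mul_assoc, coe_comm]
  have hz0 : 0 ≤ φ z := by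
    have := hφ.nonneg z
    rwa [minZ_star hz, minZ_mul_self hz] at this
  set ψ : D.alg n →ₗ[ℂ] ℂ := φ ∘ₗ LinearMap.mulLeft ℂ (z : D.alg n) with hψ
  have hψa : ∀ x, ψ x = φ (z * x) := fun x => rfl
  have hψpos : ∀ x, 0 ≤ ψ (star x * x) := fun x => by
    rw [hψa, hsq]
    exact hφ.nonneg _
  -- If `φ z = 0`, no normalization is possible, but Cauchy–Schwarz shows that `φ` vanishes on `z
  -- Aₙ`. Otherwise division by `φ z` gives a KMS state and uniqueness applies.
  by_cases h0 : φ z = 0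
  · have h1 := norm_map_star_mul_le hψpos 1 a
    rw [star_one, one_mul, one_mul, hψa 1, mul_one, h0] at h1
    have h2 : ψ a = 0 := by simpa using h1
    rw [← hψa, h2, h0, zero_mul]
  · have hstate : D.IsNormalKMSState β n z ((φ z)⁻¹ • ψ) := by
      refine ⟨fun x => ?_, fun x => ?_, ?_, ?_, fun x y hx hy => ?_⟩
      · rw [LinearMap.smul_apply, LinearMap.smul_apply, hψa, hψa, ← mul_assoc, minZ_mul_self hz]
      · rw [LinearMap.smul_apply, smul_eq_mul]
        exact mul_nonneg (inv_nonneg.2 hz0) (hψpos x)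
      · rw [LinearMap.smul_apply, hψa, minZ_mul_self hz, smul_eq_mul, inv_mul_cancel₀ h0]
      · let t := D.sigmaWeak n
        exact (continuous_comp_mulLeft hφ.normal (z : D.alg n)).const_smul ((φ z)⁻¹)
      · obtain ⟨F, h1, ⟨C, h2⟩, h3, h4, h5⟩ := hφ.kms x y
        refine ⟨fun w => (φ z)⁻¹ * F w, continuousOn_const.mul h1, ⟨‖(φ z)⁻¹‖ * C, fun w hw => ?_⟩,
          h3.const_mul _, fun t => ?_, fun t => ?_⟩
        · rw [norm_mul]
          exact mul_le_mul_of_nonneg_left (h2 w hw) (norm_nonneg _)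
        · beta_reduce
          rw [h4, LinearMap.smul_apply, hψa, ← mul_assoc, hy, smul_eq_mul]
        · beta_reduce
          rw [h5, LinearMap.smul_apply, hψa, ← mul_assoc, ← coe_comm, mul_assoc, hy, smul_eq_mul]
    rw [← eq_tau hβ hz hstate, LinearMap.smul_apply, hψa, smul_eq_mul, mul_inv_cancel_left₀ h0]

/-- `τ_z` is multiplicative with respect to the center. -/
theorem tau_mul_of_center (hβ : D.HasUniqueKMSStates β) {n : ℕ} {z : D.Z n} (hz : z ∈ D.minZ n)
    (g : D.Z n) (a : D.alg n) : D.tau β n z (g * a) = D.tau β n z g * D.tau β n z a := by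
  have hτ := isNormalKMSFunctional_tau hβ hz
  have hs := (tau_spec hβ hz).supported
  set τ := D.tau β n z with hτdef
  -- For central `h` the functional `τ(h⋆h ·)` is again positive, normal and KMS, since `h⋆h` can be
  -- absorbed into the second variable of the KMS condition; so it is a multiple of `τ` on `z Aₙ`.
  -- Polarization passes from `h⋆h` to `g`.
  have key : ∀ h ∈ Subalgebra.center ℂ (D.alg n),
      τ (star h * h * a) = τ (star h * h) * τ a := fun h hh => by
    have hc : ∀ x, x * h = h * x := Subalgebra.mem_center_iff.1 hh
    have hc' : ∀ x, x * star h = star h * x := fun x => by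
      simpa using (congrArg star (hc (star x))).symm
    have hcc : ∀ x, x * (star h * h) = star h * h * x := fun x => by
      rw [← mul_assoc, hc', mul_assoc, hc, mul_assoc]
    have hφ : D.IsNormalKMSFunctional β n (τ ∘ₗ LinearMap.mulLeft ℂ (star h * h)) := by
      refine ⟨fun x => ?_, continuous_comp_mulLeft hτ.normal _, fun x y => ?_⟩
      · have : star h * h * (star x * x) = star (h * x) * (h * x) := by
          rw [← mul_assoc, ← hcc, star_mul]
          simp only [mul_assoc]
        rw [LinearMap.comp_apply, LinearMap.mulLeft_apply, this]
        exact hτ.nonneg _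
      · obtain ⟨F, h1, h2, h3, h4, h5⟩ := hτ.kms x (star h * h * y)
        refine ⟨F, h1, h2, h3, fun t => ?_, fun t => ?_⟩
        · rw [h4, LinearMap.comp_apply, LinearMap.mulLeft_apply, mul_assoc]
        · rw [h5, LinearMap.comp_apply, LinearMap.mulLeft_apply, ← mul_assoc, hcc, mul_assoc]
    have := hφ.apply_mul hβ hz a
    simp only [LinearMap.comp_apply, LinearMap.mulLeft_apply] at this
    rwa [← mul_assoc, coe_comm, mul_assoc, hs, hs] at this
  have hspan := mem_span_star_mul_self (Subalgebra.center ℂ (D.alg n)) g.2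
  refine Submodule.span_induction (p := fun x _ => τ (x * a) = τ x * τ a) ?_ ?_ ?_ ?_ hspan
  · rintro _ ⟨h, hh, rfl⟩
    exact key h hh
  · simp
  · intro x y _ _ hx hy
    rw [add_mul, map_add, map_add, hx, hy, add_mul]
  · intro c x _ hx
    rw [smul_mul_assoc, map_smul, map_smul, hx, smul_eq_mul, smul_eq_mul, mul_assoc]

/-- The minimal summands of the center are one-dimensional. -/
theorem minZ_mul_eq_smul (hβ : D.HasUniqueKMSStates β) {n : ℕ} {z : D.Z n} (hz : z ∈ D.minZ n)
    (g : D.Z n) : z * g = D.tau β n z g • z := by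
  have hτ := tau_spec hβ hz
  have hmul := tau_mul_of_center hβ hz
  obtain ⟨ι, ζ, hζ⟩ := exists_vector_of_continuous_of_nonneg hτ.normal hτ.nonneg
  set τ := D.tau β n z
  -- The defect `k` lies under `z`, and multiplicativity of `τ` on the center gives `τ(k⋆k) = 0`, so
  -- `k` kills the vector representing `τ`. If `k ≠ 0`, its support is `z`, so `z` kills that vector
  -- too, against `τ(z) = 1`.
  let k : D.Z n := z * g - τ g • z
  by_contra hne
  have hk0 : (k : D.alg n) ≠ 0 := fun h => hne (sub_eq_zero.1 (Subtype.ext h))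
  have hzk : (z : D.alg n) * k = k := by
    change (z : D.alg n) * (z * g - τ g • (z : D.alg n)) = z * g - τ g • (z : D.alg n)
    rw [mul_sub, ← mul_assoc, minZ_mul_self hz, mul_smul_comm, minZ_mul_self hz]
  have hkτ : τ (k : D.alg n) = 0 := by
    change τ ((z : D.alg n) * g - τ g • (z : D.alg n)) = 0
    rw [map_sub, hτ.supported, map_smul, hτ.map_unit, smul_eq_mul, mul_one, sub_self]
  have hkk : τ (star (k : D.alg n) * k) = 0 := by
    rw [coe_comm, hmul, hkτ, zero_mul]
  have hkζ : ampL ι (D.rep n k) ζ = 0 := by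
    rw [hζ, map_mul, ampL_mul, map_star, mul_apply_eq_comp, ← inner_ampL_star_left, star_star] at hkk
    exact inner_self_eq_zero.1 hkk
  have hzζ : ampL ι (D.rep n z) ζ = 0 := by
    ext i
    refine IsMinimalCentralProjection.apply_eq_zero (D.rep_injective n) (D.rep_bicommutant n) hz
      (Subring.mem_center_iff.2 (coe_comm k)) hzk hk0 ?_
    have := congrArg (fun f : lp (fun _ : ι => H n) 2 => f i) hkζ
    simpa using this
  have : τ z = 0 := by rw [hζ, hzζ, inner_zero_right]
  exact one_ne_zero (hτ.map_unit.symm.trans this)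

/-! ### The conditional expectations onto the centers -/

theorem t2Space_alg (D : AtomicFlowSequence A H) (n : ℕ) : @T2Space (D.alg n) (D.sigmaWeak n) := by
  let s := sigmaWeakTopology (H n)
  let t := D.sigmaWeak n
  have := t2Space_sigmaWeak (H := H n)
  exact T2Space.of_injective_continuous (D.rep_injective n) continuous_induced_dom

theorem t2Space_Z (D : AtomicFlowSequence A H) (n : ℕ) : @T2Space (D.Z n) (D.sigmaWeakZ n) := by
  let s := D.sigmaWeak n
  let t := D.sigmaWeakZ n
  have := D.t2Space_alg n
  exact T2Space.of_injective_continuous Subtype.val_injective continuous_induced_dom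

theorem isTopologicalAddGroup_Z (D : AtomicFlowSequence A H) (n : ℕ) :
    @IsTopologicalAddGroup (D.Z n) (D.sigmaWeakZ n) _ := by
  let s := sigmaWeakTopology (H n)
  have := isTopologicalAddGroup_sigmaWeak (H := H n)
  let t := D.sigmaWeakZ n
  have : D.sigmaWeakZ n = TopologicalSpace.induced
      ((D.rep n).toAlgHom.toLinearMap ∘ₗ (Subalgebra.center ℂ (D.alg n)).val.toLinearMap)
      (sigmaWeakTopology (H n)) := by
    rw [sigmaWeakZ, sigmaWeak, induced_compose]
    rfl
  rw [this]
  exact topologicalAddGroup_induced _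

theorem hasSum_Z_iff {n : ℕ} {J : Type*} {f : J → D.Z n} {r : D.Z n} :
    @HasSum (D.Z n) J _ (D.sigmaWeakZ n) f r (SummationFilter.unconditional _) ↔
      @HasSum (D.alg n) J _ (D.sigmaWeak n) (fun j => (f j : D.alg n)) r
        (SummationFilter.unconditional _) := by
  let s := D.sigmaWeak n
  let t := D.sigmaWeakZ n
  exact (Topology.IsInducing.hasSum_iff (g := (Subalgebra.center ℂ (D.alg n)).val)
    ⟨rfl⟩ f r).symm

theorem hasSum_apply_of_continuous {n : ℕ} {J : Type*} {f : J → D.alg n} {r : D.alg n}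
    (h : @HasSum (D.alg n) J _ (D.sigmaWeak n) f r (SummationFilter.unconditional _))
    {φ : D.alg n →ₗ[ℂ] ℂ} (hφ : Continuous[D.sigmaWeak n, inferInstance] φ) :
    HasSum (fun j => φ (f j)) (φ r) := by
  let t := D.sigmaWeak n
  exact h.map φ hφ

/-- The minimal projections of the center of `Aₙ`, as a subtype of `Aₙ`. -/
def minZEquiv (D : AtomicFlowSequence A H) (n : ℕ) :
    D.minZ n ≃ {z : D.alg n // IsMinimalCentralProjection z} where
  toFun z := ⟨z, z.2⟩
  invFun z := ⟨⟨z, Subalgebra.mem_center_iff.2 (Subring.mem_center_iff.1 z.2.2.1)⟩, z.2⟩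
  left_inv _ := rfl
  right_inv _ := rfl

theorem hasSum_minZ (D : AtomicFlowSequence A H) (n : ℕ) :
    @HasSum (D.alg n) (D.minZ n) _ (D.sigmaWeak n) (fun z => ((z : D.Z n) : D.alg n)) 1
      (SummationFilter.unconditional _) := by
  let t := D.sigmaWeak n
  exact (D.minZEquiv n).hasSum_iff.2
    (hasSum_minimalCentralProjection (D.rep_injective n) (D.rep_bicommutant n) (D.atomic n))

theorem hasSum_apply_minZ_mul {n : ℕ} {φ : D.alg n →ₗ[ℂ] ℂ}
    (hφ : Continuous[D.sigmaWeak n, inferInstance] φ) (a : D.alg n) :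
    HasSum (fun z : D.minZ n => φ ((z : D.Z n) * a)) (φ a) := by
  have h := hasSum_apply_of_continuous (D.hasSum_minZ n) (continuous_comp_mulLeft hφ a)
  simp only [LinearMap.comp_apply, LinearMap.mulLeft_apply, mul_one] at h
  simpa only [coe_comm] using h

theorem minZ_mul_of_ne {n : ℕ} {z w : D.Z n} (hz : z ∈ D.minZ n) (hw : w ∈ D.minZ n)
    (h : z ≠ w) : (z : D.alg n) * w = 0 :=
  IsMinimalCentralProjection.mul_eq_zero hz hw fun e => h (Subtype.ext e)

/-- Bounded families of scalars define elements of the center. -/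
theorem exists_hasSum_smul_minZ (D : AtomicFlowSequence A H) (n : ℕ) {c : D.minZ n → ℂ} {C : ℝ}
    (hC : 0 ≤ C) (hc : ∀ z, ‖c z‖ ≤ C) :
    ∃ r : D.Z n, @HasSum (D.Z n) (D.minZ n) _ (D.sigmaWeakZ n) (fun z => c z • (z : D.Z n)) r
      (SummationFilter.unconditional _) := by
  obtain ⟨r, hrc, hr⟩ := exists_hasSum_smul_of_orthogonal (D.rep_injective n)
    (D.rep_bicommutant n) (p := fun z : D.minZ n => ((z : D.Z n) : D.alg n)) (fun z => z.2.1)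
    (fun z => z.2.2.1) (fun z w h => minZ_mul_of_ne z.2 w.2 fun e => h (Subtype.ext e)) hC hc
  exact ⟨⟨r, Subalgebra.mem_center_iff.2 (Subring.mem_center_iff.1 hrc)⟩, hasSum_Z_iff.2 hr⟩

theorem exists_isKMSExpectation (hβ : D.HasUniqueKMSStates β) (n : ℕ) :
    ∃ E, D.IsKMSExpectation β n E := by
  have hbd : ∀ (a : D.alg n) (z : D.minZ n), ‖D.tau β n z ((z : D.Z n) * a)‖ ≤ ‖D.rep n a‖ := by
    intro a z
    rw [(tau_spec hβ z.2).supported]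
    have := norm_apply_le_of_continuous_of_nonneg (tau_spec hβ z.2).normal
      (tau_spec hβ z.2).nonneg a
    rwa [tau_one hβ z.2, Complex.one_re, mul_one] at this
  choose E hE using fun a : D.alg n =>
    D.exists_hasSum_smul_minZ n (norm_nonneg (D.rep n a)) (hbd a)
  let t := D.sigmaWeakZ n
  have := D.t2Space_Z n
  have := D.isTopologicalAddGroup_Z n
  refine ⟨{ toFun := E, map_add' := fun a b => ?_, map_smul' := fun c a => ?_ }, hE⟩
  · refine (hE (a + b)).unique ?_
    convert (hE a).add (hE b) using 2 with z
    rw [mul_add, map_add, add_smul]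
  · have h1 := hE (c • a)
    refine h1.unique ?_
    rw [hasSum_Z_iff]
    have h2 := hasSum_Z_iff.1 (hE a)
    let s := D.sigmaWeak n
    -- Homogeneity uses that scalar multiplication is left multiplication by a scalar multiple of
    -- the unit, which is `σ`-weakly continuous.
    have hcont : Continuous fun x : D.alg n => algebraMap ℂ (D.alg n) c * x :=
      continuous_sigmaWeak_mul_left_alg n _
    convert h2.map (AddMonoidHom.mulLeft (algebraMap ℂ (D.alg n) c)) hcont using 2 with z
    · change D.tau β n z ((z : D.Z n) * (c • a)) • ((z : D.Z n) : D.alg n) =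
        algebraMap ℂ (D.alg n) c * (D.tau β n z ((z : D.Z n) * a) • ((z : D.Z n) : D.alg n))
      rw [mul_smul_comm, map_smul, ← Algebra.smul_def, smul_smul, smul_eq_mul]
    · change c • (E a : D.alg n) = algebraMap ℂ (D.alg n) c * (E a : D.alg n)
      rw [Algebra.smul_def]

theorem isKMSExpectation_E (hβ : D.HasUniqueKMSStates β) (n : ℕ) :
    D.IsKMSExpectation β n (D.E β n) :=
  Classical.epsilon_spec (exists_isKMSExpectation hβ n)

theorem hasSum_E (hβ : D.HasUniqueKMSStates β) (n : ℕ) (a : D.alg n) :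
    @HasSum (D.Z n) (D.minZ n) _ (D.sigmaWeakZ n)
      (fun z => D.tau β n z a • (z : D.Z n)) (D.E β n a) (SummationFilter.unconditional _) := by
  have h := isKMSExpectation_E hβ n a
  have h' : ∀ z : D.minZ n, D.tau β n z ((z : D.Z n) * a) = D.tau β n z a := fun z =>
    (tau_spec hβ z.2).supported a
  simpa only [h'] using h

theorem hasSum_apply_E (hβ : D.HasUniqueKMSStates β) {n : ℕ} {φ : D.alg n →ₗ[ℂ] ℂ}
    (hφ : Continuous[D.sigmaWeak n, inferInstance] φ) (a : D.alg n) :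
    HasSum (fun z : D.minZ n => φ (z : D.Z n) * D.tau β n z a) (φ (D.E β n a)) := by
  have h := hasSum_apply_of_continuous (hasSum_Z_iff.1 (hasSum_E hβ n a)) hφ
  convert h using 2 with z
  change _ = φ (D.tau β n z a • ((z : D.Z n) : D.alg n))
  rw [map_smul, smul_eq_mul, mul_comm]

/-- Normal KMS functionals factor through the conditional expectation. -/
theorem IsNormalKMSFunctional.apply_E (hβ : D.HasUniqueKMSStates β) {n : ℕ}
    {φ : D.alg n →ₗ[ℂ] ℂ} (hφ : D.IsNormalKMSFunctional β n φ) (a : D.alg n) :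
    φ (D.E β n a) = φ a := by
  refine (hasSum_apply_E hβ hφ.normal a).unique ?_
  convert hasSum_apply_minZ_mul hφ.normal a using 2 with z
  rw [hφ.apply_mul hβ z.2]

theorem E_eq_of_tau_eq (hβ : D.HasUniqueKMSStates β) {n : ℕ} {a b : D.alg n}
    (h : ∀ z ∈ D.minZ n, D.tau β n z a = D.tau β n z b) : D.E β n a = D.E β n b := by
  let t := D.sigmaWeakZ n
  have := D.t2Space_Z n
  refine (hasSum_E hβ n a).unique ?_
  convert hasSum_E hβ n b using 2 with z
  rw [h z z.2]

/-- `Eₙ` is the identity on the center. -/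
theorem E_coe (hβ : D.HasUniqueKMSStates β) {n : ℕ} (g : D.Z n) : D.E β n g = g := by
  have h1 := hasSum_Z_iff.1 (hasSum_E hβ n (g : D.alg n))
  let t := D.sigmaWeak n
  have := D.t2Space_alg n
  refine Subtype.ext (h1.unique ?_)
  have h2 : Continuous fun x : D.alg n => (g : D.alg n) * x := continuous_sigmaWeak_mul_left_alg n _
  have h3 := (D.hasSum_minZ n).map (AddMonoidHom.mulLeft (g : D.alg n)) h2
  rw [AddMonoidHom.coe_mulLeft, mul_one] at h3
  refine h3.congr_fun fun z => ?_
  change _ = (g : D.alg n) * ((z : D.Z n) : D.alg n)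
  rw [← minZ_mul_eq_smul hβ z.2 g, ← coe_comm]
  rfl

/-- The composite is `∑ φ(z) τ_z`. Its coefficients are absolutely summable because `φ(1) = ∑ φ(z)`
converges unconditionally in `ℂ`. -/
theorem continuous_apply_E (hβ : D.HasUniqueKMSStates β) {n : ℕ} {φ : D.alg n →ₗ[ℂ] ℂ}
    (hφ : Continuous[D.sigmaWeak n, inferInstance] φ) :
    Continuous[D.sigmaWeak n, inferInstance] fun a => φ (D.E β n a) := by
  have hs : Summable fun z : D.minZ n => ‖φ (z : D.Z n)‖ :=
    (hasSum_apply_of_continuous (D.hasSum_minZ n) hφ).summable.norm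
  have h := continuous_tsum_mul (π := D.rep n) (τ := fun z : D.minZ n => D.tau β n z)
    (fun z => (tau_spec hβ z.2).normal) (fun z => (tau_spec hβ z.2).nonneg)
    (fun z => by rw [tau_one hβ z.2, Complex.one_re]) hs
  simp only [(hasSum_apply_E hβ hφ _).tsum_eq] at h
  exact h

theorem continuous_vecFunctional {n : ℕ} (ξ η : lp (fun _ : ℕ => H n) 2) :
    Continuous[D.sigmaWeak n, inferInstance] (vecFunctional (D.rep n) ξ η) := by
  let s := sigmaWeakTopology (H n)
  let t := D.sigmaWeak n
  exact (continuous_sigmaWeak_inner_nat ξ η).comp continuous_induced_dom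

theorem continuous_E (hβ : D.HasUniqueKMSStates β) (n : ℕ) :
    Continuous[D.sigmaWeak n, D.sigmaWeakZ n] (D.E β n) := by
  rw [sigmaWeakZ, sigmaWeak, induced_compose]
  refine continuous_induced_rng.2 ?_
  rw [continuous_sigmaWeak_rng_iff]
  intro ξ η
  exact continuous_apply_E hβ (continuous_vecFunctional ξ η)

theorem tau_E (hβ : D.HasUniqueKMSStates β) {n : ℕ} {z : D.Z n} (hz : z ∈ D.minZ n)
    (a : D.alg n) : D.tau β n z (D.E β n a) = D.tau β n z a :=
  (isNormalKMSFunctional_tau hβ hz).apply_E hβ a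

theorem eq_of_tau_eq (hβ : D.HasUniqueKMSStates β) {n : ℕ} {f g : D.Z n}
    (h : ∀ z ∈ D.minZ n, D.tau β n z f = D.tau β n z g) : f = g := by
  rw [← E_coe hβ f, ← E_coe hβ g, E_eq_of_tau_eq hβ h]

theorem tau_of_hasSum (hβ : D.HasUniqueKMSStates β) {n : ℕ} {c : D.minZ n → ℂ} {r : D.Z n}
    (h : @HasSum (D.Z n) (D.minZ n) _ (D.sigmaWeakZ n) (fun z => c z • (z : D.Z n)) r
      (SummationFilter.unconditional _)) (z : D.minZ n) : D.tau β n z r = c z := by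
  have hτ := tau_spec hβ z.2
  refine (hasSum_apply_of_continuous (hasSum_Z_iff.1 h) hτ.normal).unique ?_
  have hval : ∀ w : D.minZ n, D.tau β n z ((c w • (w : D.Z n) : D.Z n) : D.alg n) =
      c w * D.tau β n z (w : D.Z n) := fun w => map_smul (D.tau β n z) (c w) ((w : D.Z n) : D.alg n)
  convert hasSum_single z fun w hw => ?_ using 1
  · rw [hval, hτ.map_unit, mul_one]
  · rw [hval, ← hτ.supported, minZ_mul_of_ne z.2 w.2 fun e => hw (Subtype.ext e.symm), map_zero,
      mul_zero]

/-- `Eₙ` maps positive elements to positive elements. -/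
theorem exists_E_star_mul_self (hβ : D.HasUniqueKMSStates β) {n : ℕ} (a : D.alg n) :
    ∃ g : D.alg n, (D.E β n (star a * a) : D.alg n) = star g * g := by
  let c : D.minZ n → ℂ := fun z => D.tau β n z (star a * a)
  have hc0 : ∀ z, 0 ≤ c z := fun z => (tau_spec hβ z.2).nonneg a
  have hcb : ∀ z, (c z).re ≤ ‖D.rep n (star a * a)‖ := fun z => by
    have := norm_apply_le_of_continuous_of_nonneg (tau_spec hβ z.2).normal
      (tau_spec hβ z.2).nonneg (star a * a)
    rw [tau_one hβ z.2, Complex.one_re, mul_one] at this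
    exact (Complex.re_le_norm _).trans this
  -- A square root of `Eₙ(a⋆a)` is built coefficientwise, with the coefficient `√τ_z(a⋆a)` at `z`.
  obtain ⟨g, hg⟩ := D.exists_hasSum_smul_minZ n (c := fun z => (Real.sqrt (c z).re : ℂ))
    (Real.sqrt_nonneg ‖D.rep n (star a * a)‖) fun z => by
      rw [Complex.norm_real, Real.norm_of_nonneg (Real.sqrt_nonneg _)]
      exact Real.sqrt_le_sqrt (hcb z)
  let g' : D.Z n := ⟨star (g : D.alg n), Subalgebra.mem_center_iff.2 fun b => by
    simpa using (congrArg star (coe_comm g (star b))).symm⟩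
  refine ⟨g, ?_⟩
  have : D.E β n (star a * a) = g' * g := eq_of_tau_eq hβ fun z hz => by
    have hgz := tau_of_hasSum hβ hg ⟨z, hz⟩
    have h1 : D.tau β n z (g' * g : D.Z n) = D.tau β n z (star (g : D.alg n)) * D.tau β n z g :=
      tau_mul_of_center hβ hz g' g
    rw [tau_E hβ hz, h1, map_star_of_nonneg (tau_spec hβ hz).nonneg, hgz, RCLike.star_def,
      Complex.conj_ofReal, ← Complex.ofReal_mul, Real.mul_self_sqrt (Complex.nonneg_iff.1 (hc0 ⟨z, hz⟩)).1]
    exact Complex.ext rfl (Complex.nonneg_iff.1 (hc0 ⟨z, hz⟩)).2.symm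
  rw [this]
  rfl

variable (I : D.LeftMultiplicativeStructure)

/-! ### The product of two central elements -/

/-- The bilinear map `(a, b) ↦ ι_{m,n}(a ⊗ b)`. -/
def LeftMultiplicativeStructure.ten (m n : ℕ) : D.alg m →ₗ[ℂ] D.alg n →ₗ[ℂ] D.alg (m + n) :=
  LinearMap.mk₂ ℂ (fun a b => I.iota m n (D.tmul a b))
    (fun a a' b => by
      rw [← map_add]
      exact congrArg _ (Subtype.ext (by
        change opTensor _ _ = opTensor _ _ + opTensor _ _
        rw [map_add, opTensor_add_left])))
    (fun c a b => by
      rw [← map_smul]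
      exact congrArg _ (Subtype.ext (by
        change opTensor _ _ = c • opTensor _ _
        rw [map_smul, opTensor_smul_left])))
    (fun a b b' => by
      rw [← map_add]
      exact congrArg _ (Subtype.ext (by
        change opTensor _ _ = opTensor _ _ + opTensor _ _
        rw [map_add, opTensor_add_right])))
    (fun c a b => by
      rw [← map_smul]
      exact congrArg _ (Subtype.ext (by
        change opTensor _ _ = c • opTensor _ _
        rw [map_smul, opTensor_smul_right])))

theorem ten_apply {m n : ℕ} (a : D.alg m) (b : D.alg n) :
    I.ten m n a b = I.iota m n (D.tmul a b) := rfl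

theorem ten_mul {m n : ℕ} (a a' : D.alg m) (b b' : D.alg n) :
    I.ten m n a b * I.ten m n a' b' = I.ten m n (a * a') (b * b') := by
  rw [ten_apply, ten_apply, ten_apply, ← map_mul]
  exact congrArg _ (Subtype.ext (by
    change opTensor _ _ * opTensor _ _ = opTensor _ _
    rw [map_mul, map_mul, opTensor_mul]))

theorem ten_star {m n : ℕ} (a : D.alg m) (b : D.alg n) :
    star (I.ten m n a b) = I.ten m n (star a) (star b) := by
  rw [ten_apply, ten_apply, ← map_star]
  exact congrArg _ (Subtype.ext (by
    change star (opTensor _ _) = opTensor _ _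
    rw [map_star, map_star, opTensor_star]))

theorem flowOn_ten {m n : ℕ} (t : ℝ) (a : D.alg m) (b : D.alg n) :
    D.flowOn (m + n) t (I.ten m n a b) = I.ten m n (D.flowOn m t a) (D.flowOn n t b) :=
  (I.flow m n t a b).symm

theorem ten_star_mul_self {m n : ℕ} (a : D.alg m) (b : D.alg n) :
    I.ten m n (star a * a) (star b * b) = star (I.ten m n a b) * I.ten m n a b := by
  rw [ten_star, ten_mul]

theorem continuous_ten_left {m n : ℕ} (b : D.alg n) :
    Continuous[D.sigmaWeak m, D.sigmaWeak (m + n)] fun a => I.ten m n a b := by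
  let t := D.sigmaWeak m
  let t' := D.sigmaWeak (m + n)
  let s := D.sigmaWeakTensor m n
  let u := sigmaWeakTopology (H m)
  let u' := sigmaWeakTopology (HilbertTensor (H m) (H n))
  refine (I.normal m n).comp (continuous_induced_rng.2 ?_)
  exact (continuous_opTensor_left (D.rep n b)).comp continuous_induced_dom

theorem continuous_ten_right {m n : ℕ} (a : D.alg m) :
    Continuous[D.sigmaWeak n, D.sigmaWeak (m + n)] fun b => I.ten m n a b := by
  let t := D.sigmaWeak n
  let t' := D.sigmaWeak (m + n)
  let s := D.sigmaWeakTensor m n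
  let u := sigmaWeakTopology (H n)
  let u' := sigmaWeakTopology (HilbertTensor (H m) (H n))
  refine (I.normal m n).comp (continuous_induced_rng.2 ?_)
  exact (continuous_opTensor_right (D.rep m a)).comp continuous_induced_dom

/-- The function on the strip for `a, b` is the one of `φ` for `a ⊗ 1` and `b ⊗ h⋆h`: the flow acts
on `a ⊗ 1` only through `a`, so `h⋆h` stays fixed in the other factor. The square is needed for
positivity. -/
theorem IsNormalKMSFunctional.ten_left {m n : ℕ} {φ : D.alg (m + n) →ₗ[ℂ] ℂ}
    (hφ : D.IsNormalKMSFunctional β (m + n) φ) (h : D.alg n) :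
    D.IsNormalKMSFunctional β m (φ ∘ₗ (I.ten m n).flip (star h * h)) := by
  refine ⟨fun a => ?_, ?_, fun a b => ?_⟩
  · rw [LinearMap.comp_apply, LinearMap.flip_apply, ten_star_mul_self]
    exact hφ.nonneg _
  · let t := D.sigmaWeak m
    let t' := D.sigmaWeak (m + n)
    exact hφ.normal.comp (continuous_ten_left I (star h * h))
  · obtain ⟨F, h1, h2, h3, h4, h5⟩ := hφ.kms (I.ten m n a 1) (I.ten m n b (star h * h))
    refine ⟨F, h1, h2, h3, fun t => ?_, fun t => ?_⟩
    · rw [h4, flowOn_ten, D.flowOn_one, ten_mul, mul_one]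
      rfl
    · rw [h5, flowOn_ten, D.flowOn_one, ten_mul, one_mul]
      rfl

theorem IsNormalKMSFunctional.ten_right {m n : ℕ} {φ : D.alg (m + n) →ₗ[ℂ] ℂ}
    (hφ : D.IsNormalKMSFunctional β (m + n) φ) (h : D.alg m) :
    D.IsNormalKMSFunctional β n (φ ∘ₗ I.ten m n (star h * h)) := by
  refine ⟨fun a => ?_, ?_, fun a b => ?_⟩
  · rw [LinearMap.comp_apply, ten_star_mul_self]
    exact hφ.nonneg _
  · let t := D.sigmaWeak n
    let t' := D.sigmaWeak (m + n)
    exact hφ.normal.comp (continuous_ten_right I (star h * h))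
  · obtain ⟨F, h1, h2, h3, h4, h5⟩ := hφ.kms (I.ten m n 1 a) (I.ten m n (star h * h) b)
    refine ⟨F, h1, h2, h3, fun t => ?_, fun t => ?_⟩
    · rw [h4, flowOn_ten, D.flowOn_one, ten_mul, mul_one]
      rfl
    · rw [h5, flowOn_ten, D.flowOn_one, ten_mul, one_mul]
      rfl

theorem mem_span_star_mul_self_alg {n : ℕ} (b : D.alg n) :
    b ∈ Submodule.span ℂ {x : D.alg n | ∃ h ∈ (⊤ : Subalgebra ℂ (D.alg n)), x = star h * h} :=
  mem_span_star_mul_self ⊤ Algebra.mem_top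

/-- After applying `τ_z`, both sides are linear in `b`, so `b` may be taken to be a square. Then
`ten_left` supplies a normal KMS functional in `a`, which does not distinguish `a` from `E a`. -/
theorem E_ten_E_left (hβ : D.HasUniqueKMSStates β) {m n : ℕ} (a : D.alg m) (b : D.alg n) :
    D.E β (m + n) (I.ten m n (D.E β m a) b) = D.E β (m + n) (I.ten m n a b) := by
  refine E_eq_of_tau_eq hβ fun z hz => ?_
  have h := LinearMap.eqOn_span (s := {x : D.alg n | ∃ h ∈ (⊤ : Subalgebra ℂ (D.alg n)), x = star h * h})
    (f := D.tau β (m + n) z ∘ₗ I.ten m n (D.E β m a))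
    (g := D.tau β (m + n) z ∘ₗ I.ten m n a) ?_
  · exact h (mem_span_star_mul_self_alg b)
  · rintro _ ⟨h, -, rfl⟩
    exact ((isNormalKMSFunctional_tau hβ hz).ten_left I h).apply_E hβ a

theorem E_ten_E_right (hβ : D.HasUniqueKMSStates β) {m n : ℕ} (a : D.alg m) (b : D.alg n) :
    D.E β (m + n) (I.ten m n a (D.E β n b)) = D.E β (m + n) (I.ten m n a b) := by
  refine E_eq_of_tau_eq hβ fun z hz => ?_
  have h := LinearMap.eqOn_span (s := {x : D.alg m | ∃ h ∈ (⊤ : Subalgebra ℂ (D.alg m)), x = star h * h})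
    (f := D.tau β (m + n) z ∘ₗ (I.ten m n).flip (D.E β n b))
    (g := D.tau β (m + n) z ∘ₗ (I.ten m n).flip b) ?_
  · exact h (mem_span_star_mul_self_alg a)
  · rintro _ ⟨h, -, rfl⟩
    exact ((isNormalKMSFunctional_tau hβ hz).ten_right I h).apply_E hβ b

/-- The bilinear map `(f, g) ↦ Eₘ₊ₙ(ι_{m,n}(f ⊗ g))`. -/
def LeftMultiplicativeStructure.prodL (β : ℝ) (m n : ℕ) : D.Z m →ₗ[ℂ] D.Z n →ₗ[ℂ] D.Z (m + n) :=
  ((I.ten m n).compl₁₂ (Subalgebra.center ℂ (D.alg m)).val.toLinearMap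
    (Subalgebra.center ℂ (D.alg n)).val.toLinearMap).compr₂ (D.E β (m + n))

theorem prodL_apply {m n : ℕ} (f : D.Z m) (g : D.Z n) : I.prodL β m n f g = prodZ I β f g := rfl

theorem prodZ_eq {m n : ℕ} (f : D.Z m) (g : D.Z n) :
    prodZ I β f g = D.E β (m + n) (I.ten m n f g) := rfl

/-- The algebras indexed by `l + m + n` and `l + (m + n)` are different types. Identities between
them are stated after applying a family `F` with a common target: the inclusions into `Σ`, the maps
to `S̈`, or the coercions to `A`. -/
theorem apply_E_congr {M : Type*} (F : ∀ n, D.Z n → M) {k k' : ℕ} (h : k = k') {a : D.alg k}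
    {b : D.alg k'} (hab : (a : A) = b) : F k (D.E β k a) = F k' (D.E β k' b) := by
  subst h
  rw [Subtype.ext hab]

theorem apply_prodZ_assoc (hβ : D.HasUniqueKMSStates β) {M : Type*} (F : ∀ n, D.Z n → M)
    {l m n : ℕ} (f : D.Z l) (g : D.Z m) (h : D.Z n) :
    F _ (prodZ I β (prodZ I β f g) h) = F _ (prodZ I β f (prodZ I β g h)) := by
  rw [prodZ_eq I (prodZ I β f g), prodZ_eq I f g, E_ten_E_left I hβ, prodZ_eq I f,
    prodZ_eq I g h, E_ten_E_right I hβ]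
  exact apply_E_congr F (add_assoc l m n) (I.assoc l m n f g h)

theorem apply_one_prodZ (hβ : D.HasUniqueKMSStates β) {M : Type*} (F : ∀ n, D.Z n → M)
    {n : ℕ} (g : D.Z n) : F _ (prodZ I β (1 : D.Z 0) g) = F n g := by
  conv_rhs => rw [← E_coe hβ g]
  refine apply_E_congr F (zero_add n) ?_
  have := I.zero_left n 1 g
  rwa [map_one, one_smul] at this

theorem prodZ_one_zero (hβ : D.HasUniqueKMSStates β) {n : ℕ} (g : D.Z n) :
    prodZ I β g (1 : D.Z 0) = g := by
  conv_rhs => rw [← E_coe hβ g]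
  refine congrArg (D.E β n) (Subtype.ext ?_)
  have := I.zero_right n g 1
  rwa [map_one, one_smul] at this

theorem prodZ_one_one {n : ℕ} (f : D.Z n) : prodZ I β f (1 : D.Z 1) = D.thetaStep β n f :=
  congrArg (D.E β (n + 1)) (Subtype.ext (I.left n f))

/-- Associativity with third factor `1₁`. Here `m + (n + 1)` and `m + n + 1` agree definitionally,
so both sides have the same type. -/
theorem prodZ_thetaStep (hβ : D.HasUniqueKMSStates β) {m n : ℕ} (f : D.Z m) (g : D.Z n) :
    prodZ I β f (D.thetaStep β n g) = D.thetaStep β (m + n) (prodZ I β f g) := by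
  rw [← prodZ_one_one I g, ← prodZ_one_one I (prodZ I β f g)]
  exact (Subtype.ext (Subtype.ext
    (apply_prodZ_assoc I hβ (fun n x => ((x : D.alg n) : A)) f g (1 : D.Z 1)))).symm

theorem continuous_prodZ_right (hβ : D.HasUniqueKMSStates β) {m n : ℕ} (f : D.Z m) :
    Continuous[D.sigmaWeakZ n, D.sigmaWeakZ (m + n)] fun g => prodZ I β f g := by
  let t := D.sigmaWeak n
  let t' := D.sigmaWeak (m + n)
  let s := D.sigmaWeakZ n
  let s' := D.sigmaWeakZ (m + n)
  exact (continuous_E hβ (m + n)).comp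
    ((continuous_ten_right I (f : D.alg m)).comp continuous_induced_dom)

theorem continuous_prodZ_left (hβ : D.HasUniqueKMSStates β) {m n : ℕ} (g : D.Z n) :
    Continuous[D.sigmaWeakZ m, D.sigmaWeakZ (m + n)] fun f => prodZ I β f g := by
  let t := D.sigmaWeak m
  let t' := D.sigmaWeak (m + n)
  let s := D.sigmaWeakZ m
  let s' := D.sigmaWeakZ (m + n)
  exact (continuous_E hβ (m + n)).comp
    ((continuous_ten_left I (g : D.alg n)).comp continuous_induced_dom)

/-! ### The algebra `Σ` -/

/-- The multiplication of `Σ`. -/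
def LeftMultiplicativeStructure.mulSig (β : ℝ) : D.Sig →ₗ[ℂ] D.Sig →ₗ[ℂ] D.Sig :=
  DirectSum.toModule ℂ ℕ _ fun k => LinearMap.flip (DirectSum.toModule ℂ ℕ _ fun l =>
    LinearMap.flip ((I.prodL β k l).compr₂ (D.inSig (k + l))))

theorem mulSig_inSig {k l : ℕ} (f : D.Z k) (g : D.Z l) :
    I.mulSig β (D.inSig k f) (D.inSig l g) = D.inSig (k + l) (prodZ I β f g) := by
  simp only [LeftMultiplicativeStructure.mulSig, inSig, DirectSum.toModule_lof,
    LinearMap.flip_apply, LinearMap.compr₂_apply, prodL_apply]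

theorem sig_induction {p : D.Sig → Prop} (x : D.Sig) (h0 : p 0)
    (hof : ∀ n (f : D.Z n), p (D.inSig n f)) (hadd : ∀ x y, p x → p y → p (x + y)) : p x :=
  DirectSum.induction_on x h0 hof fun x y => hadd x y

theorem mulSig_assoc (hβ : D.HasUniqueKMSStates β) (x y w : D.Sig) :
    I.mulSig β (I.mulSig β x y) w = I.mulSig β x (I.mulSig β y w) := by
  induction x using sig_induction with
  | h0 => simp
  | hadd x x' hx hx' => simp only [map_add, LinearMap.add_apply, hx, hx']
  | hof l f =>
    induction y using sig_induction with
    | h0 => simp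
    | hadd x x' hx hx' => simp only [map_add, LinearMap.add_apply, hx, hx']
    | hof m g =>
      induction w using sig_induction with
      | h0 => simp
      | hadd x x' hx hx' => simp only [map_add, hx, hx']
      | hof n h =>
        simp only [mulSig_inSig]
        exact apply_prodZ_assoc I hβ (fun n => D.inSig n) f g h

theorem one_mulSig (hβ : D.HasUniqueKMSStates β) (x : D.Sig) :
    I.mulSig β (D.oneSig 0) x = x := by
  induction x using sig_induction with
  | h0 => simp
  | hadd x x' hx hx' => simp only [map_add, hx, hx']
  | hof n f =>
    rw [oneSig, mulSig_inSig]
    exact apply_one_prodZ I hβ (fun n => D.inSig n) f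

theorem mulSig_one (hβ : D.HasUniqueKMSStates β) (x : D.Sig) :
    I.mulSig β x (D.oneSig 0) = x := by
  induction x using sig_induction with
  | h0 => simp
  | hadd x x' hx hx' => simp only [map_add, LinearMap.add_apply, hx, hx']
  | hof n f =>
    rw [oneSig, mulSig_inSig, prodZ_one_zero I hβ]
    rfl

theorem mulSig_inSig_one {n : ℕ} (f : D.Z n) :
    I.mulSig β (D.inSig n f) (D.oneSig 1) = D.inSig (n + 1) (D.thetaStep β n f) := by
  rw [oneSig, mulSig_inSig, prodZ_one_one]

theorem inSig_apply_self {n : ℕ} (f : D.Z n) : D.inSig n f n = f :=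
  DirectSum.lof_apply ℂ n f

theorem inSig_apply_of_ne {m n : ℕ} (f : D.Z m) (h : m ≠ n) : D.inSig m f n = 0 :=
  DirectSum.of_eq_of_ne m n f h.symm

/-- Multiplication by a homogeneous element shifts degrees, so each component of the product depends
on one component of `y`. With the vanishing in degrees below `k`, continuity on `Σ` reduces to
continuity of `prodZ`. -/
theorem mulSig_inSig_left_apply {k : ℕ} (f : D.Z k) (y : D.Sig) (l : ℕ) :
    I.mulSig β (D.inSig k f) y (k + l) = prodZ I β f (y l) := by
  induction y using sig_induction with
  | h0 => simp [← prodL_apply]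
  | hadd x y hx hy => simp only [map_add, DirectSum.add_apply, hx, hy, ← prodL_apply]
  | hof m g =>
    rw [mulSig_inSig]
    rcases eq_or_ne m l with rfl | h
    · rw [inSig_apply_self, inSig_apply_self]
    · rw [inSig_apply_of_ne _ h, inSig_apply_of_ne _ (by omega), ← prodL_apply, map_zero]

theorem mulSig_inSig_left_apply_of_lt {k : ℕ} (f : D.Z k) (y : D.Sig) {n : ℕ} (h : n < k) :
    I.mulSig β (D.inSig k f) y n = 0 := by
  induction y using sig_induction with
  | h0 => simp
  | hadd x y hx hy => rw [map_add, DirectSum.add_apply, hx, hy, add_zero]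
  | hof m g => rw [mulSig_inSig, inSig_apply_of_ne _ (by omega)]

theorem mulSig_inSig_right_apply {l : ℕ} (g : D.Z l) (x : D.Sig) (k : ℕ) :
    I.mulSig β x (D.inSig l g) (k + l) = prodZ I β (x k) g := by
  induction x using sig_induction with
  | h0 => simp [← prodL_apply]
  | hadd x y hx hy =>
    simp only [map_add, LinearMap.add_apply, DirectSum.add_apply, hx, hy, ← prodL_apply]
  | hof m f =>
    rw [mulSig_inSig]
    rcases eq_or_ne m k with rfl | h
    · rw [inSig_apply_self, inSig_apply_self]
    · rw [inSig_apply_of_ne _ h, inSig_apply_of_ne _ (by omega), ← prodL_apply, map_zero,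
        LinearMap.zero_apply]

theorem mulSig_inSig_right_apply_of_lt {l : ℕ} (g : D.Z l) (x : D.Sig) {n : ℕ} (h : n < l) :
    I.mulSig β x (D.inSig l g) n = 0 := by
  induction x using sig_induction with
  | h0 => simp
  | hadd x y hx hy =>
    rw [map_add, LinearMap.add_apply, DirectSum.add_apply, hx, hy, add_zero]
  | hof m f => rw [mulSig_inSig, inSig_apply_of_ne _ (by omega)]

theorem continuous_topSig_rng_iff {X : Type*} {t : TopologicalSpace X} {F : X → D.Sig} :
    Continuous[t, D.topSig] F ↔ ∀ n, Continuous[t, D.sigmaWeakZ n] fun x => F x n := by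
  let s := D.sigmaWeakZ
  rw [continuous_induced_rng, continuous_pi_iff]
  rfl

theorem continuous_topSig_apply (n : ℕ) :
    Continuous[D.topSig, D.sigmaWeakZ n] fun x : D.Sig => x n :=
  (continuous_topSig_rng_iff (t := D.topSig) (F := id)).1
    (@continuous_id _ D.topSig) n

theorem continuous_topSig_of_add {F G : D.Sig → D.Sig}
    (hF : Continuous[D.topSig, D.topSig] F) (hG : Continuous[D.topSig, D.topSig] G) :
    Continuous[D.topSig, D.topSig] fun x => F x + G x := by
  refine continuous_topSig_rng_iff.2 fun n => ?_
  let t := D.sigmaWeakZ n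
  let t' := D.topSig
  have := D.isTopologicalAddGroup_Z n
  exact (continuous_topSig_rng_iff.1 hF n).add (continuous_topSig_rng_iff.1 hG n)

theorem continuous_topSig_zero :
    Continuous[D.topSig, D.topSig] fun _ : D.Sig => (0 : D.Sig) :=
  @continuous_const _ _ D.topSig D.topSig _

theorem continuous_mulSig_right (hβ : D.HasUniqueKMSStates β) (x : D.Sig) :
    Continuous[D.topSig, D.topSig] fun y => I.mulSig β x y := by
  induction x using sig_induction with
  | h0 => simpa using continuous_topSig_zero
  | hadd x y hx hy => simpa using continuous_topSig_of_add hx hy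
  | hof k f =>
    refine continuous_topSig_rng_iff.2 fun n => ?_
    rcases lt_or_ge n k with h | h
    · simp only [mulSig_inSig_left_apply_of_lt I f _ h]
      exact @continuous_const _ _ D.topSig (D.sigmaWeakZ n) _
    · obtain ⟨l, rfl⟩ := Nat.exists_eq_add_of_le h
      simp only [mulSig_inSig_left_apply]
      let t := D.topSig
      let s := D.sigmaWeakZ l
      let s' := D.sigmaWeakZ (k + l)
      exact (continuous_prodZ_right I hβ f).comp (continuous_topSig_apply l)

theorem continuous_mulSig_left (hβ : D.HasUniqueKMSStates β) (y : D.Sig) :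
    Continuous[D.topSig, D.topSig] fun x => I.mulSig β x y := by
  induction y using sig_induction with
  | h0 => simpa using continuous_topSig_zero
  | hadd x y hx hy => simpa using continuous_topSig_of_add hx hy
  | hof l g =>
    refine continuous_topSig_rng_iff.2 fun n => ?_
    rcases lt_or_ge n l with h | h
    · simp only [mulSig_inSig_right_apply_of_lt I g _ h]
      exact @continuous_const _ _ D.topSig (D.sigmaWeakZ n) _
    · obtain ⟨k, rfl⟩ := Nat.exists_eq_add_of_le' h
      simp only [mulSig_inSig_right_apply]
      let t := D.topSig
      let s := D.sigmaWeakZ k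
      let s' := D.sigmaWeakZ (k + l)
      exact (continuous_prodZ_left I hβ g).comp (continuous_topSig_apply k)

/-! ### The inductive limits as modules -/

theorem theta_succ {m n : ℕ} (h : m ≤ n) (h' : m ≤ n + 1) (f : D.Z m) :
    D.theta β m (n + 1) h' f = D.thetaStep β n (D.theta β m n h f) := by
  rw [theta, Nat.leRec_succ _ _ h]
  rfl

theorem theta_self (m : ℕ) (f : D.Z m) : D.theta β m m le_rfl f = f := by
  rw [theta, Nat.leRec_self]
  rfl

theorem ddotTheta_thetaStep {n : ℕ} (f : D.Z n) :
    D.ddotTheta β (n + 1) (D.thetaStep β n f) = D.ddotTheta β n f := by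
  have h : D.theta β n (n + 1) n.le_succ f = D.thetaStep β n f := by
    rw [theta_succ le_rfl, theta_self]
  rw [← h]
  exact Module.DirectLimit.of_f

theorem apply_theta {M : Type*} {g : ∀ n, D.Z n → M}
    (hg : ∀ n (f : D.Z n), g (n + 1) (D.thetaStep β n f) = g n f) {m n : ℕ} (h : m ≤ n)
    (f : D.Z m) : g n (D.theta β m n h f) = g m f := by
  induction n, h using Nat.le_induction with
  | base => rw [theta_self]
  | succ n h ih => rw [theta_succ h, hg, ih]

theorem ddotS_induction {p : D.DdotS β → Prop} (s : D.DdotS β)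
    (h : ∀ n (f : D.Z n), p (D.ddotTheta β n f)) : p s := by
  obtain ⟨n, f, rfl⟩ := Module.DirectLimit.exists_of s
  exact h n f

/-- The linear map out of `S̈` given by a compatible sequence of linear maps. -/
def liftDdotS {M : Type*} [AddCommGroup M] [Module ℂ M] (g : ∀ n, D.Z n →ₗ[ℂ] M)
    (hg : ∀ n (f : D.Z n), g (n + 1) (D.thetaStep β n f) = g n f) : D.DdotS β →ₗ[ℂ] M :=
  Module.DirectLimit.lift ℂ ℕ D.Z (D.theta β) g fun _ _ h f =>
    apply_theta (g := fun n => g n) hg h f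

theorem liftDdotS_ddotTheta {M : Type*} [AddCommGroup M] [Module ℂ M] (g : ∀ n, D.Z n →ₗ[ℂ] M)
    (hg : ∀ n (f : D.Z n), g (n + 1) (D.thetaStep β n f) = g n f) {n : ℕ} (f : D.Z n) :
    liftDdotS g hg (D.ddotTheta β n f) = g n f :=
  Module.DirectLimit.lift_of (f := D.theta β) g
    (fun _ _ h f => apply_theta (g := fun n => g n) hg h f) f

/-- The bilinear map `𝒵(Aₘ) × S̈ → S̈` extending the product of central elements. -/
def LeftMultiplicativeStructure.ddotActZ (hβ : D.HasUniqueKMSStates β) (m : ℕ) :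
    D.DdotS β →ₗ[ℂ] D.Z m →ₗ[ℂ] D.DdotS β :=
  liftDdotS (M := D.Z m →ₗ[ℂ] D.DdotS β)
    (fun n => ((I.prodL β m n).compr₂ (D.ddotTheta β (m + n))).flip)
    fun n g => LinearMap.ext fun f => by
      change D.ddotTheta β (m + n + 1) (prodZ (m := m) (n := n + 1) I β f (D.thetaStep β n g)) =
        D.ddotTheta β (m + n) (prodZ I β f g)
      rw [prodZ_thetaStep I hβ, ddotTheta_thetaStep]

/-- The action of `Σ` on `S̈`. -/
def LeftMultiplicativeStructure.ddotAct (hβ : D.HasUniqueKMSStates β) :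
    D.Sig →ₗ[ℂ] D.DdotS β →ₗ[ℂ] D.DdotS β :=
  DirectSum.toModule ℂ ℕ _ fun m => (I.ddotActZ hβ m).flip

theorem ddotAct_inSig (hβ : D.HasUniqueKMSStates β) {m n : ℕ} (f : D.Z m) (g : D.Z n) :
    I.ddotAct hβ (D.inSig m f) (D.ddotTheta β n g) = D.ddotTheta β (m + n) (prodZ I β f g) := by
  rw [LeftMultiplicativeStructure.ddotAct, inSig, DirectSum.toModule_lof, LinearMap.flip_apply,
    LeftMultiplicativeStructure.ddotActZ, liftDdotS_ddotTheta]
  rfl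

theorem ddotAct_mulSig (hβ : D.HasUniqueKMSStates β) (x y : D.Sig) (s : D.DdotS β) :
    I.ddotAct hβ (I.mulSig β x y) s = I.ddotAct hβ x (I.ddotAct hβ y s) := by
  induction x using sig_induction with
  | h0 => simp
  | hadd x x' hx hx' => simp only [map_add, LinearMap.add_apply, hx, hx']
  | hof l f =>
    induction y using sig_induction with
    | h0 => simp
    | hadd x x' hx hx' => simp only [map_add, LinearMap.add_apply, hx, hx']
    | hof m g =>
      induction s using ddotS_induction with
      | h n h =>
        simp only [mulSig_inSig, ddotAct_inSig]
        exact apply_prodZ_assoc I hβ (fun n => D.ddotTheta β n) f g h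

theorem ddotAct_one (hβ : D.HasUniqueKMSStates β) (s : D.DdotS β) :
    I.ddotAct hβ (D.oneSig 0) s = s := by
  induction s using ddotS_induction with
  | h n f =>
    rw [oneSig, ddotAct_inSig]
    exact apply_one_prodZ I hβ (fun n => D.ddotTheta β n) f

theorem ddotAct_ddotE (hβ : D.HasUniqueKMSStates β) {m : ℕ} (f : D.Z m) :
    I.ddotAct hβ (D.inSig m f) (D.ddotE β) = D.ddotTheta β m f := by
  rw [ddotE, ddotAct_inSig, prodZ_one_zero I hβ]
  rfl

/-! #### Archimedeanization -/

theorem ddotE_mem_ddotCone (D : AtomicFlowSequence A H) (β : ℝ) : D.ddotE β ∈ D.ddotCone β :=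
  ⟨0, 1, ⟨1, by simp⟩, rfl⟩

/-- Positive functionals vanish on the kernel of the Archimedeanization. -/
theorem apply_eq_zero_of_mem_archKernel {s : D.DdotS β} (hs : s ∈ D.archKernel β)
    {φ ψ : D.DdotS β →ₗ[ℂ] ℂ} (hφ : D.IsStateDdotS β φ) (hψ : ∀ s ∈ D.ddotCone β, 0 ≤ ψ s) :
    ψ s = 0 := by
  have hst : ∀ χ, D.IsStateDdotS β χ → χ s = 0 := fun χ hχ => by
    simp only [archKernel, Submodule.mem_iInf] at hs
    exact hs ⟨χ, hχ⟩
  have he : 0 ≤ ψ (D.ddotE β) := hψ _ (D.ddotE_mem_ddotCone β)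
  set c := ψ (D.ddotE β)
  have hc : 1 + c ≠ 0 := fun h => by
    have h1 := (Complex.nonneg_iff.1 he).1
    have h2 := congrArg Complex.re h
    simp at h2
    linarith
  -- Since `ψ(ë)` may be zero, `ψ` alone cannot always be normalized; the sum `φ + ψ` takes the
  -- value `1 + ψ(ë) > 0` at `ë`, and dividing by it gives a state.
  have h := hst ((1 + c)⁻¹ • (φ + ψ)) ⟨fun t ht => ?_, ?_⟩
  · rw [LinearMap.smul_apply, LinearMap.add_apply, hst φ hφ, zero_add, smul_eq_mul,
      mul_eq_zero] at h
    exact h.resolve_left (inv_ne_zero hc)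
  · rw [LinearMap.smul_apply, smul_eq_mul]
    exact mul_nonneg (inv_nonneg.2 (add_nonneg zero_le_one he))
      (add_nonneg (hφ.1 t ht) (hψ t ht))
  · rw [LinearMap.smul_apply, LinearMap.add_apply, hφ.2, smul_eq_mul]
    exact inv_mul_cancel₀ hc

theorem ddotAct_mem_ddotCone (hβ : D.HasUniqueKMSStates β) {m : ℕ} {f : D.Z m}
    (hf : ∃ h : D.alg m, (f : D.alg m) = star h * h) {s : D.DdotS β} (hs : s ∈ D.ddotCone β) :
    I.ddotAct hβ (D.inSig m f) s ∈ D.ddotCone β := by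
  obtain ⟨h, hh⟩ := hf
  obtain ⟨n, g, ⟨k, hk⟩, rfl⟩ := hs
  refine ⟨m + n, prodZ I β f g, ?_, ddotAct_inSig I hβ f g⟩
  rw [prodZ_eq, hh, hk, ten_star_mul_self]
  exact exists_E_star_mul_self hβ _

theorem ddotAct_mem_archKernel (hβ : D.HasUniqueKMSStates β) (x : D.Sig) {s : D.DdotS β}
    (hs : s ∈ D.archKernel β) : I.ddotAct hβ x s ∈ D.archKernel β := by
  induction x using sig_induction with
  | h0 => simp
  | hadd x y hx hy =>
    rw [map_add, LinearMap.add_apply]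
    exact Submodule.add_mem _ hx hy
  | hof m f =>
    -- Centrality is carried inside the predicate because the span is formed in `Aₘ`. On a generator
    -- `h⋆h` the action preserves the cone, so each state pulls back to a positive functional; the
    -- state itself serves as the auxiliary `φ` in `apply_eq_zero_of_mem_archKernel`.
    have key : ∃ hc : (f : D.alg m) ∈ Subalgebra.center ℂ (D.alg m),
        I.ddotAct hβ (D.inSig m ⟨f, hc⟩) s ∈ D.archKernel β := by
      refine Submodule.span_induction (p := fun x _ =>
        ∃ hc : x ∈ Subalgebra.center ℂ (D.alg m),
          I.ddotAct hβ (D.inSig m ⟨x, hc⟩) s ∈ D.archKernel β) ?_ ?_ ?_ ?_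
        (mem_span_star_mul_self (Subalgebra.center ℂ (D.alg m)) f.2)
      · rintro _ ⟨h, hh, rfl⟩
        have hh' : star h * h ∈ Subalgebra.center ℂ (D.alg m) :=
          Subalgebra.mul_mem _ (Subalgebra.mem_center_iff.2 fun b => by
            simpa using (congrArg star (Subalgebra.mem_center_iff.1 hh (star b))).symm) hh
        refine ⟨hh', ?_⟩
        rw [archKernel, Submodule.mem_iInf]
        rintro ⟨φ, hφ⟩
        exact apply_eq_zero_of_mem_archKernel hs (ψ := φ ∘ₗ I.ddotAct hβ (D.inSig m ⟨_, hh'⟩)) hφ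
          fun t ht => hφ.1 _ (ddotAct_mem_ddotCone I hβ ⟨h, rfl⟩ ht)
      · refine ⟨Subalgebra.zero_mem _, ?_⟩
        have : (⟨0, Subalgebra.zero_mem _⟩ : D.Z m) = 0 := rfl
        rw [this, map_zero, map_zero, LinearMap.zero_apply]
        exact Submodule.zero_mem _
      · rintro x y - - ⟨hx, hx'⟩ ⟨hy, hy'⟩
        refine ⟨Subalgebra.add_mem _ hx hy, ?_⟩
        have : (⟨x + y, Subalgebra.add_mem _ hx hy⟩ : D.Z m) = ⟨x, hx⟩ + ⟨y, hy⟩ := rfl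
        rw [this, map_add, map_add, LinearMap.add_apply]
        exact Submodule.add_mem _ hx' hy'
      · rintro c x - ⟨hx, hx'⟩
        refine ⟨Subalgebra.smul_mem _ hx c, ?_⟩
        have : (⟨c • x, Subalgebra.smul_mem _ hx c⟩ : D.Z m) = c • ⟨x, hx⟩ := rfl
        rw [this, map_smul, map_smul, LinearMap.smul_apply]
        exact Submodule.smul_mem _ c hx'
    exact key.2

/-- The action of `Σ` on `S`. -/
def LeftMultiplicativeStructure.act (hβ : D.HasUniqueKMSStates β) :
    D.Sig →ₗ[ℂ] D.S β →ₗ[ℂ] D.S β where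
  toFun x := Submodule.mapQ _ _ (I.ddotAct hβ x) fun _ hs => ddotAct_mem_archKernel I hβ x hs
  map_add' x y := by
    ext s
    simp
  map_smul' c x := by
    ext s
    simp

/-! #### `S̈` as a quotient of `Σ` -/

theorem ddotAct_ddotE_surjective (hβ : D.HasUniqueKMSStates β) :
    Function.Surjective fun x => I.ddotAct hβ x (D.ddotE β) := fun s => by
  induction s using ddotS_induction with
  | h n f => exact ⟨D.inSig n f, ddotAct_ddotE I hβ f⟩

theorem ker_ddotAct_ddotE (hβ : D.HasUniqueKMSStates β) :
    LinearMap.ker ((I.ddotAct hβ).flip (D.ddotE β)) =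
      LinearMap.range ((I.mulSig β).flip (D.oneSig 1 - D.oneSig 0)) := by
  set L := LinearMap.range ((I.mulSig β).flip (D.oneSig 1 - D.oneSig 0)) with hL
  have hmul : ∀ n (f : D.Z n), I.mulSig β (D.inSig n f) (D.oneSig 1 - D.oneSig 0) =
      D.inSig (n + 1) (D.thetaStep β n f) - D.inSig n f := fun n f => by
    rw [map_sub, mulSig_inSig_one, mulSig_one I hβ]
  apply le_antisymm
  -- Modulo `L` the elements `Θ(f)` and `f` agree, so the inclusions of the centers induce a map `r`
  -- on the limit. It sends `x · ë` to the class of `x`, which forces the kernel into `L`.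
  · let r : D.DdotS β →ₗ[ℂ] D.Sig ⧸ L := liftDdotS (fun n => L.mkQ ∘ₗ D.inSig n) fun n f => by
      rw [LinearMap.comp_apply, LinearMap.comp_apply, ← sub_eq_zero, ← map_sub, ← hmul]
      exact (Submodule.Quotient.mk_eq_zero L).2 ⟨D.inSig n f, rfl⟩
    have hr : ∀ x, r (I.ddotAct hβ x (D.ddotE β)) = L.mkQ x := fun x => by
      induction x using sig_induction with
      | h0 => simp
      | hadd x y hx hy => simp only [map_add, LinearMap.add_apply, hx, hy]
      | hof n f =>
        rw [ddotAct_ddotE, liftDdotS_ddotTheta]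
        rfl
    intro x hx
    have hx' : I.ddotAct hβ x (D.ddotE β) = 0 := hx
    have := hr x
    rw [hx', map_zero] at this
    exact (Submodule.Quotient.mk_eq_zero L).1 this.symm
  · rintro _ ⟨x, rfl⟩
    change I.ddotAct hβ (I.mulSig β x (D.oneSig 1 - D.oneSig 0)) (D.ddotE β) = 0
    induction x using sig_induction with
    | h0 => simp
    | hadd x y hx hy => simp only [map_add, LinearMap.add_apply, hx, hy, add_zero]
    | hof n f =>
      rw [hmul, map_sub, LinearMap.sub_apply, ddotAct_ddotE, ddotAct_ddotE, ddotTheta_thetaStep,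
        sub_self]

end AtomicFlowSequence

end

/-- The operations are given as bilinear maps with prescribed values on homogeneous elements and on
the images of the canonical maps. These values determine them, and their existence is the
well-definedness of the formulas. The identities for `S` are the images of those for `S̈` under the
quotient map. -/
theorem theorem3p14 {A : Type*} [CStarAlgebra A] [Nontrivial A] {H : ℕ → Type*}
    [∀ n, NormedAddCommGroup (H n)] [∀ n, InnerProductSpace ℂ (H n)]
    [∀ n, CompleteSpace (H n)]
    (D : AtomicFlowSequence A H) (β : ℝ) (hβ : D.HasUniqueKMSStates β)
    (I : D.LeftMultiplicativeStructure) :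
    -- the maps `Eₙ` are given by the `σ`-weakly convergent sums that define them
    (∀ n, D.IsKMSExpectation β n (D.E β n)) ∧
    ∃ (mul : D.Sig →ₗ[ℂ] D.Sig →ₗ[ℂ] D.Sig)
      (ddotAct : D.Sig →ₗ[ℂ] D.DdotS β →ₗ[ℂ] D.DdotS β)
      (act : D.Sig →ₗ[ℂ] D.S β →ₗ[ℂ] D.S β),
      -- (1) `Σ` is a unital algebra with separately continuous multiplication
      ((∀ (k l : ℕ) (f : D.Z k) (g : D.Z l),
          mul (D.inSig k f) (D.inSig l g) =
            D.inSig (k + l) (AtomicFlowSequence.prodZ I β f g)) ∧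
        (∀ x y w, mul (mul x y) w = mul x (mul y w)) ∧
        (∀ x, mul (D.oneSig 0) x = x) ∧ (∀ x, mul x (D.oneSig 0) = x) ∧
        (∀ x, Continuous[D.topSig, D.topSig] fun y => mul x y) ∧
        (∀ y, Continuous[D.topSig, D.topSig] fun x => mul x y)) ∧
      -- (2) `S̈` and `S` are left `Σ`-modules
      ((∀ (m n : ℕ) (f : D.Z m) (g : D.Z n),
          ddotAct (D.inSig m f) (D.ddotTheta β n g) =
            D.ddotTheta β (m + n) (AtomicFlowSequence.prodZ I β f g)) ∧
        (∀ x y s, ddotAct (mul x y) s = ddotAct x (ddotAct y s)) ∧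
        (∀ s, ddotAct (D.oneSig 0) s = s) ∧
        (∀ (m n : ℕ) (f : D.Z m) (g : D.Z n),
          act (D.inSig m f) (D.ThetaInf β n g) =
            D.ThetaInf β (m + n) (AtomicFlowSequence.prodZ I β f g)) ∧
        (∀ x y s, act (mul x y) s = act x (act y s)) ∧
        (∀ s, act (D.oneSig 0) s = s) ∧
        (∀ (m : ℕ) (f : D.Z m),
          ddotAct (D.inSig m f) (D.ddotE β) = D.ddotTheta β m f ∧
          act (D.inSig m f) (D.unitS β) = D.ThetaInf β m f)) ∧
      -- (3) multiplication by `1₁`, and the description of `S̈` as a quotient of `Σ`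
      ((∀ (n : ℕ) (f : D.Z n),
          mul (D.inSig n f) (D.oneSig 1) = D.inSig (n + 1) (D.thetaStep β n f)) ∧
        Function.Surjective (fun x => ddotAct x (D.ddotE β)) ∧
        LinearMap.ker (ddotAct.flip (D.ddotE β)) =
          LinearMap.range (mul.flip (D.oneSig 1 - D.oneSig 0)) ∧
        ∃ Φ : (D.Sig ⧸ LinearMap.range (mul.flip (D.oneSig 1 - D.oneSig 0))) ≃ₗ[ℂ] D.DdotS β,
          (∀ x, Φ (Submodule.Quotient.mk x) = ddotAct x (D.ddotE β)) ∧
          ∀ x y, Φ (Submodule.Quotient.mk (mul x y)) =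
            ddotAct x (Φ (Submodule.Quotient.mk y))) := by
  refine ⟨AtomicFlowSequence.isKMSExpectation_E hβ, I.mulSig β, I.ddotAct hβ, I.act hβ,
    ⟨fun k l f g => AtomicFlowSequence.mulSig_inSig I f g,
      AtomicFlowSequence.mulSig_assoc I hβ, AtomicFlowSequence.one_mulSig I hβ,
      AtomicFlowSequence.mulSig_one I hβ, AtomicFlowSequence.continuous_mulSig_right I hβ,
      AtomicFlowSequence.continuous_mulSig_left I hβ⟩,
    ⟨fun m n f g => AtomicFlowSequence.ddotAct_inSig I hβ f g,
      AtomicFlowSequence.ddotAct_mulSig I hβ, AtomicFlowSequence.ddotAct_one I hβ,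
      fun m n f g => ?_, fun x y s => ?_, fun s => ?_,
      fun m f => ⟨AtomicFlowSequence.ddotAct_ddotE I hβ f, ?_⟩⟩,
    fun n f => AtomicFlowSequence.mulSig_inSig_one I f,
    AtomicFlowSequence.ddotAct_ddotE_surjective I hβ,
    AtomicFlowSequence.ker_ddotAct_ddotE I hβ, ?_⟩
  · exact congrArg (D.archKernel β).mkQ (AtomicFlowSequence.ddotAct_inSig I hβ f g)
  · obtain ⟨s, rfl⟩ := (D.archKernel β).mkQ_surjective s
    exact congrArg (D.archKernel β).mkQ (AtomicFlowSequence.ddotAct_mulSig I hβ x y s)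
  · obtain ⟨s, rfl⟩ := (D.archKernel β).mkQ_surjective s
    exact congrArg (D.archKernel β).mkQ (AtomicFlowSequence.ddotAct_one I hβ s)
  · exact congrArg (D.archKernel β).mkQ (AtomicFlowSequence.ddotAct_ddotE I hβ f)
  · refine ⟨(Submodule.quotEquivOfEq _ _ (AtomicFlowSequence.ker_ddotAct_ddotE I hβ).symm).trans
      (((I.ddotAct hβ).flip (D.ddotE β)).quotKerEquivOfSurjective
        (AtomicFlowSequence.ddotAct_ddotE_surjective I hβ)), fun x => rfl, fun x y => ?_⟩
    exact AtomicFlowSequence.ddotAct_mulSig I hβ x y (D.ddotE β)
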